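/- Let $n\ge 1$ and let $f_1,\dots,f_n:\mathbb{R}^d\to\mathbb{R}$ be twice continuously differentiable functions that are, for constants $\mu,L>0$ and $\tilde L\ge 0$, $\mu$-strongly convex and $L$-smooth, i.e. $\frac{\mu}{2}\|y-x\|^2\le f_i(y)-f_i(x)-\langle\nabla f_i(x),y-x\rangle\le\frac{L}{2}\|y-x\|^2$ for all $x,y$, and have $\tilde L$-Lipschitz Hessians, i.e. $\|\nabla^2f_i(y)-\nabla^2f_i(x)\|\le\tilde L\|y-x\|$ for all $x,y$ (spectral norm). Let $x^\star=\arg\min_x\frac1n\sum_{i=1}^nf_i(x)$ and $M=\tilde L\mu^{-3/2}$. For matrices $B,K$ put $\sigma(B,K)=\mathrm{Tr}\big((K^{-1})^{\mathsf T}(B-K)\big)$ and, for a vector $u\neq 0$, $$\mathrm{BFGS}(B,K,u)=B-\frac{Buu^{\mathsf T}B}{\langle u,Bu\rangle}+\frac{Kuu^{\mathsf T}K}{\langle u,Ku\rangle},\qquad \mathrm{BFGS}(B,K,0)=B.$$ Given $\rho,\epsilon>0$, put $\alpha_k=M\sqrt L\,\epsilon\rho^k$ for $k\ge 0$. Given $x^0\in\mathbb{R}^d$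 and matrices $I_1^0,\dots,I_n^0$, the SLIQN method sets $z_i^0=x^0$, $D_i^0=(1+\alpha_0)^2I_i^0$ for all $i$, and for $t=1,2,\dots$, with $i_t=1+(t-1)\bmod n$ and $\omega_t=(1+\alpha_{\lceil t/n\rceil})^2$ if $n\mid t$, $\omega_t=1$ otherwise: - $x^t=\big(\sum_{i=1}^nD_i^{t-1}\big)^{-1}\sum_{i=1}^n\big(D_i^{t-1}z_i^{t-1}-\nabla f_i(z_i^{t-1})\big)$; - $z_{i_t}^t=x^t$, and $z_i^t=z_i^{t-1}$, $D_i^t=\omega_tD_i^{t-1}$ for $i\ne i_t$; - $Q^t=\mathrm{BFGS}\big(D_{i_t}^{t-1},(1+\alpha_{\lceil t/n-1\rceil})K^t,z_{i_t}^t-z_{i_t}^{t-1}\big)$, where $K^t=\int_0^1\nabla^2f_{i_t}\big(z_{i_t}^{t-1}+\tau(z_{i_t}^t-z_{i_t}^{t-1})\big)\,d\tau$; - $D_{i_t}^t=\omega_t\,\mathrm{BFGS}\big(Q^t,\nabla^2f_{i_t}(z_{i_t}^t),\bar u^t\big)$, where $\bar u^t$ is any maximizer of $\langle u,Q^tu\rangle/\langle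 u,\nabla^2f_{i_t}(z_{i_t}^t)u\rangle$ over the standard basis vectors $u\in\{e_1,\dots,e_d\}$. Then for every $\rho$ with $0<\rho<1-\frac{\mu}{dL}$ there exist $\epsilon>0$ and $\sigma_0>0$ such that, whenever $\|x^0-x^\star\|\le\epsilon$ and, for all $i\in\{1,\dots,n\}$, $I_i^0-\nabla^2f_i(x^0)$ is symmetric positive semidefinite and $\sigma(I_i^0,\nabla^2f_i(x^0))\le\sigma_0$, all sequences generated by the SLIQN method with $\alpha_k=M\sqrt L\,\epsilon\rho^k$ satisfy, for all $t\ge 1$: the matrices $D_i^{t-1}$ ($1\le i\le n$) and $Q^t$ are positive definite (so every step is well defined), and $$\|x^t-x^\star\|\le\Big(1-\frac{\mu}{dL}\Big)^{\lceil t/n\rceil}\,\frac1n\sum_{i=1}^n\|x^{t-i}-x^\star\|,$$ where $x^{t-i}:=x^0$ if $t<i$. -/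

import Mathlib

noncomputable section

namespace SLIQN

/-- The Hessian of `f` at `x` as a linear operator: the derivative of the gradient.
Its operator norm is the spectral norm. -/
def hessOp {d : ℕ} (f : EuclideanSpace ℝ (Fin d) → ℝ) (x : EuclideanSpace ℝ (Fin d)) :
    EuclideanSpace ℝ (Fin d) →L[ℝ] EuclideanSpace ℝ (Fin d) :=
  fderiv ℝ (gradient f) x

/-- The Hessian matrix of `f` at `x`. -/
def hess {d : ℕ} (f : EuclideanSpace ℝ (Fin d) → ℝ) (x : EuclideanSpace ℝ (Fin d)) :
    Matrix (Fin d) (Fin d) ℝ :=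
  (Matrix.toEuclideanCLM (n := Fin d) (𝕜 := ℝ)).symm (hessOp f x)

/-- The averaged Hessian `∫₀¹ ∇²f(x + τ (y - x)) dτ` (entrywise integral). -/
def avgHess {d : ℕ} (f : EuclideanSpace ℝ (Fin d) → ℝ) (x y : EuclideanSpace ℝ (Fin d)) :
    Matrix (Fin d) (Fin d) ℝ :=
  Matrix.of fun i j => ∫ τ in (0 : ℝ)..1, hess f (x + τ • (y - x)) i j

/-- `f` is `μ`-strongly convex: `(μ/2)‖y - x‖² ≤ f y - f x - ⟨∇f x, y - x⟩`. -/
def StronglyConvex {d : ℕ} (μ : ℝ) (f : EuclideanSpace ℝ (Fin d) → ℝ) : Prop :=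
  ∀ x y, μ / 2 * ‖y - x‖ ^ 2 ≤ f y - f x - inner ℝ (gradient f x) (y - x)

/-- `f` is `L`-smooth: `f y - f x - ⟨∇f x, y - x⟩ ≤ (L/2)‖y - x‖²`. -/
def Smooth {d : ℕ} (L : ℝ) (f : EuclideanSpace ℝ (Fin d) → ℝ) : Prop :=
  ∀ x y, f y - f x - inner ℝ (gradient f x) (y - x) ≤ L / 2 * ‖y - x‖ ^ 2

/-- The Hessian of `f` is `Lt`-Lipschitz in the spectral norm. -/
def LipschitzHessian {d : ℕ} (Lt : ℝ) (f : EuclideanSpace ℝ (Fin d) → ℝ) : Prop :=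
  ∀ x y, ‖hessOp f y - hessOp f x‖ ≤ Lt * ‖y - x‖

/-- The generalized BFGS update `B - B u uᵀ B / ⟨u, B u⟩ + K u uᵀ K / ⟨u, K u⟩`.
For `u = 0` it returns `B` (there is no direction to update along). -/
def bfgs {d : ℕ} (B K : Matrix (Fin d) (Fin d) ℝ) (u : Fin d → ℝ) :
    Matrix (Fin d) (Fin d) ℝ :=
  B - (u ⬝ᵥ B.mulVec u)⁻¹ • (B * Matrix.vecMulVec u u * B)
    + (u ⬝ᵥ K.mulVec u)⁻¹ • (K * Matrix.vecMulVec u u * K)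

/-- `u` is a greedy vector of `B` with respect to `K`: it maximizes `⟨u, B u⟩ / ⟨u, K u⟩` among
the standard basis vectors. Ties may be broken in any way. -/
def IsGreedy {d : ℕ} (B K : Matrix (Fin d) (Fin d) ℝ) (u : Fin d → ℝ) : Prop :=
  u ∈ Set.range (fun k : Fin d => (Pi.single k 1 : Fin d → ℝ)) ∧
    IsMaxOn (fun v : Fin d → ℝ => (v ⬝ᵥ B.mulVec v) / (v ⬝ᵥ K.mulVec v))
      (Set.range (fun k : Fin d => (Pi.single k 1 : Fin d → ℝ))) u

/-- The approximation error `σ(B, K) = ⟨K⁻¹, B - K⟩`, with `⟨X, Y⟩ = Tr(Xᵀ Y)`. -/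
def sigma {d : ℕ} (B K : Matrix (Fin d) (Fin d) ℝ) : ℝ :=
  ((K⁻¹).transpose * (B - K)).trace

/-- The index `i_t` updated at iteration `t ≥ 1`, in zero-based numbering: `(t - 1) mod n`. -/
def idx (n : ℕ) [NeZero n] (t : ℕ) : Fin n :=
  ⟨(t - 1) % n, Nat.mod_lt _ (NeZero.pos n)⟩

/-- The correction factors `α_k = M √L ε ρ ^ k`, with `M = Lt μ ^ (-3/2)`. -/
def alpha (μ L Lt ε ρ : ℝ) (k : ℕ) : ℝ :=
  Lt * μ ^ (-(3 / 2) : ℝ) * √L * ε * ρ ^ k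

/-- The scaling `ω_t`: equal to `(1 + α_⌈t/n⌉)²` if `n ∣ t`, and to `1` otherwise. -/
def omega (α : ℕ → ℝ) (n t : ℕ) : ℝ :=
  if t % n = 0 then (1 + α ⌈(t : ℝ) / n⌉₊) ^ 2 else 1

/-- `(x, z, D, Q, u)` is a run of SLIQN on `f_1, …, f_n` with correction factors `α`, started
from the point `x0` and the matrices `I0 i`. Here `x t`, `z t i`, `D t i` are the iterates and
`Q t`, `u t` (for `t ≥ 1`) are the intermediate matrix and the greedy vector of iteration `t`. -/
structure IsRun {d n : ℕ} [NeZero n] (f : Fin n → EuclideanSpace ℝ (Fin d) → ℝ) (α : ℕ → ℝ)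
    (x0 : EuclideanSpace ℝ (Fin d)) (I0 : Fin n → Matrix (Fin d) (Fin d) ℝ)
    (x : ℕ → EuclideanSpace ℝ (Fin d)) (z : ℕ → Fin n → EuclideanSpace ℝ (Fin d))
    (D : ℕ → Fin n → Matrix (Fin d) (Fin d) ℝ) (Q : ℕ → Matrix (Fin d) (Fin d) ℝ)
    (u : ℕ → Fin d → ℝ) : Prop where
  x_init : x 0 = x0
  z_init : ∀ i, z 0 i = x0
  D_init : ∀ i, D 0 i = (1 + α 0) ^ 2 • I0 i
  x_step : ∀ t, 1 ≤ t → (x t).ofLp =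
    (∑ i, D (t - 1) i)⁻¹.mulVec
      (∑ i, ((D (t - 1) i).mulVec (z (t - 1) i).ofLp - (gradient (f i) (z (t - 1) i)).ofLp))
  z_active : ∀ t, 1 ≤ t → z t (idx n t) = x t
  z_rest : ∀ t, 1 ≤ t → ∀ i, i ≠ idx n t → z t i = z (t - 1) i
  D_rest : ∀ t, 1 ≤ t → ∀ i, i ≠ idx n t → D t i = omega α n t • D (t - 1) i
  Q_step : ∀ t, 1 ≤ t → Q t =
    bfgs (D (t - 1) (idx n t))
      ((1 + α ⌈(t : ℝ) / n - 1⌉₊) •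
        avgHess (f (idx n t)) (z (t - 1) (idx n t)) (z t (idx n t)))
      (z t (idx n t) - z (t - 1) (idx n t)).ofLp
  u_greedy : ∀ t, 1 ≤ t → IsGreedy (Q t) (hess (f (idx n t)) (z t (idx n t))) (u t)
  D_active : ∀ t, 1 ≤ t → D t (idx n t) =
    omega α n t • bfgs (Q t) (hess (f (idx n t)) (z t (idx n t))) (u t)

end SLIQN

end

namespace SLIQN

open Matrix

/-! ### Quadratic forms, the Loewner order and traces -/

section Form

variable {d : ℕ} {A B E : Matrix (Fin d) (Fin d) ℝ}

/-! Group the iterations into epochs of `n`, and put `q = 1 - μ/(dL)`. At the start of epoch `p`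
every stored point is within `R p = ε ρ^p` of the minimizer, and every `D i` dominates `(1 + α p)^2`
times its Hessian. Strong convexity turns the Lipschitz bound into a relative one: the Hessians at
the old and new points and their average `K` agree up to a factor `1 + α p`. Hence `(1 + α p) K`
lies below `D` and above the new Hessian, so both BFGS updates keep the required domination
(`bfgs_avgHess`).

The error `sigma` contracts by `q` in the greedy update (`sigma_bfgs_greedy_le`), while the
corrections multiply `sigma + d` by `(1 + α p)^4` per epoch. Since `α p` is proportional to `ρ^p`
with `ρ < q`, this inflation is summable relative to `q^p`, and `sigma = O(q^p)` survives
(`one_add_mul_pow_le`).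

A quasi-Newton step contracts the average distance by `(L sigma + Lt R)/μ` (`norm_step_le`), which
is at most `ρ q^p` for small initial data. This factor closes the induction on the radii
(`inv_step`) and is at most `q^(p+1)`, the claimed rate. -/

lemma dot_mulVec_comm (hA : A.IsHermitian) (v w : Fin d → ℝ) :
    v ⬝ᵥ A *ᵥ w = w ⬝ᵥ A *ᵥ v := by
  have h : Aᵀ = A := by simpa using hA.eq
  rw [dotProduct_mulVec, ← mulVec_transpose, h, dotProduct_comm]

lemma form_nonneg (hA : A.PosSemidef) (v : Fin d → ℝ) : 0 ≤ v ⬝ᵥ A *ᵥ v := by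
  simpa using hA.dotProduct_mulVec_nonneg v

lemma form_pos (hA : A.PosDef) {v : Fin d → ℝ} (hv : v ≠ 0) : 0 < v ⬝ᵥ A *ᵥ v := by
  simpa using hA.dotProduct_mulVec_pos hv

lemma form_le (h : (B - A).PosSemidef) (v : Fin d → ℝ) : v ⬝ᵥ A *ᵥ v ≤ v ⬝ᵥ B *ᵥ v := by
  have := form_nonneg h v
  rw [sub_mulVec, dotProduct_sub] at this
  linarith

lemma posSemidef_sub_of_form_le (hA : A.IsHermitian) (hB : B.IsHermitian)
    (h : ∀ v, v ⬝ᵥ A *ᵥ v ≤ v ⬝ᵥ B *ᵥ v) : (B - A).PosSemidef := by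
  refine PosSemidef.of_dotProduct_mulVec_nonneg (hB.sub hA) fun v => ?_
  rw [star_trivial, sub_mulVec, dotProduct_sub]
  linarith [h v]

lemma posDef_of_form_le (hA : A.IsHermitian) {μ : ℝ} (hμ : 0 < μ)
    (h : ∀ v : Fin d → ℝ, μ * (v ⬝ᵥ v) ≤ v ⬝ᵥ A *ᵥ v) : A.PosDef := by
  refine PosDef.of_dotProduct_mulVec_pos hA fun v hv => ?_
  rw [star_trivial]
  have : 0 < v ⬝ᵥ v := by
    simpa using dotProduct_star_self_pos_iff.2 hv
  nlinarith [h v, mul_pos hμ this]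

lemma posDef_of_posSemidef_sub (h : (B - A).PosSemidef) (hA : A.PosDef) : B.PosDef := by
  simpa using hA.add_posSemidef h

lemma form_add_smul (hA : A.IsHermitian) (v w : Fin d → ℝ) (s : ℝ) :
    (v + s • w) ⬝ᵥ A *ᵥ (v + s • w) =
      v ⬝ᵥ A *ᵥ v + 2 * s * (w ⬝ᵥ A *ᵥ v) + s ^ 2 * (w ⬝ᵥ A *ᵥ w) := by
  simp only [mulVec_add, mulVec_smul, dotProduct_add, add_dotProduct, dotProduct_smul,
    smul_dotProduct, smul_eq_mul, dot_mulVec_comm hA v w]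
  ring

/-- The Fenchel–Young inequality for the quadratic form of `A`. -/
lemma two_mul_dot_le (hA : A.PosDef) (v w : Fin d → ℝ) :
    2 * (v ⬝ᵥ w) ≤ v ⬝ᵥ A⁻¹ *ᵥ v + w ⬝ᵥ A *ᵥ w := by
  have hdet : IsUnit A.det := (isUnit_iff_isUnit_det A).1 hA.isUnit
  have h := form_nonneg hA.posSemidef (A⁻¹ *ᵥ v + (-1 : ℝ) • w)
  rw [form_add_smul hA.isHermitian, mulVec_mulVec, mul_nonsing_inv A hdet, one_mulVec,
    dotProduct_comm (A⁻¹ *ᵥ v) v, dotProduct_comm w v] at h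
  linarith

lemma sq_dot_le (hE : E.PosSemidef) (v w : Fin d → ℝ) :
    (w ⬝ᵥ E *ᵥ v) ^ 2 ≤ (w ⬝ᵥ E *ᵥ w) * (v ⬝ᵥ E *ᵥ v) := by
  have h : ∀ s : ℝ, 0 ≤ (w ⬝ᵥ E *ᵥ w) * (s * s) + 2 * (w ⬝ᵥ E *ᵥ v) * s + v ⬝ᵥ E *ᵥ v := by
    intro s
    have := form_nonneg hE (v + s • w)
    rw [form_add_smul hE.isHermitian] at this
    linarith
  have := discrim_le_zero h
  rw [discrim] at this
  nlinarith

lemma posSemidef_inv_sub_inv (hA : A.PosDef) (h : (B - A).PosSemidef) :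
    (A⁻¹ - B⁻¹).PosSemidef := by
  have hB := posDef_of_posSemidef_sub h hA
  have hdet : IsUnit B.det := (isUnit_iff_isUnit_det B).1 hB.isUnit
  refine posSemidef_sub_of_form_le hB.inv.isHermitian hA.inv.isHermitian fun v => ?_
  have h1 := two_mul_dot_le hA v (B⁻¹ *ᵥ v)
  have h2 := form_le h (B⁻¹ *ᵥ v)
  rw [mulVec_mulVec v B, mul_nonsing_inv B hdet, one_mulVec, dotProduct_comm (B⁻¹ *ᵥ v) v] at h2
  linarith

lemma trace_mul_nonneg (hA : A.PosSemidef) (hB : B.PosSemidef) : 0 ≤ (A * B).trace := by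
  obtain ⟨C, rfl⟩ : ∃ C : Matrix (Fin d) (Fin d) ℝ, B = Cᴴ * C := by
    open scoped MatrixOrder in
    obtain ⟨C, hC⟩ := CStarAlgebra.nonneg_iff_eq_star_mul_self.1 hB.nonneg
    exact ⟨C, hC⟩
  rw [← Matrix.mul_assoc, trace_mul_comm, ← Matrix.mul_assoc]
  exact (hA.mul_mul_conjTranspose_same C).trace_nonneg

lemma trace_mul_vecMulVec' (K : Matrix (Fin d) (Fin d) ℝ) (a b : Fin d → ℝ) :
    (K * vecMulVec a b).trace = b ⬝ᵥ K *ᵥ a := by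
  rw [mul_vecMulVec, trace_vecMulVec, dotProduct_comm]

/-- Cauchy–Schwarz gives `v vᵀ ≼ |v|² I`; pair this with `E` under the trace. -/
lemma form_le_trace (hE : E.PosSemidef) (v : Fin d → ℝ) :
    v ⬝ᵥ E *ᵥ v ≤ E.trace * (v ⬝ᵥ v) := by
  have h1 : ((v ⬝ᵥ v) • (1 : Matrix (Fin d) (Fin d) ℝ) - vecMulVec v v).PosSemidef := by
    refine posSemidef_sub_of_form_le ?_ ?_ fun w => ?_
    · simpa using (posSemidef_vecMulVec_self_star v).isHermitian
    · exact (isHermitian_one).smul (by simp [IsSelfAdjoint])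
    · have := sq_dot_le (PosSemidef.one (n := Fin d) (R := ℝ)) v w
      simp only [one_mulVec] at this
      simp only [vecMulVec_mulVec, smul_mulVec, one_mulVec, dotProduct_smul, smul_eq_mul,
        op_smul_eq_smul]
      rw [dotProduct_comm v w]
      nlinarith
  have h2 := trace_mul_nonneg hE h1
  rw [mul_sub, trace_sub, trace_mul_vecMulVec', Matrix.mul_smul, trace_smul, mul_one, smul_eq_mul] at h2
  linarith

/-- Cauchy–Schwarz in the form of `E`, applied to `v` and `E v`, bounds `|E v|⁴`; one factor `|E
v|²` is then cancelled. -/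
lemma mulVec_dot_mulVec_le (hE : E.PosSemidef) (v : Fin d → ℝ) :
    (E *ᵥ v) ⬝ᵥ (E *ᵥ v) ≤ E.trace ^ 2 * (v ⬝ᵥ v) := by
  have h1 := sq_dot_le hE v (E *ᵥ v)
  have h2 := form_le_trace hE v
  have h3 := form_le_trace hE (E *ᵥ v)
  have h4 := form_nonneg hE v
  have h5 := form_nonneg hE (E *ᵥ v)
  have h6 : 0 ≤ (E *ᵥ v) ⬝ᵥ (E *ᵥ v) := by simpa using dotProduct_star_self_nonneg (E *ᵥ v)
  have h7 : 0 ≤ v ⬝ᵥ v := by simpa using dotProduct_star_self_nonneg v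
  rcases h6.eq_or_lt with h | h
  · rw [← h]; positivity
  · have h8 := mul_le_mul h3 h2 h4 (mul_nonneg hE.trace_nonneg h6)
    refine le_of_mul_le_mul_left ?_ h
    nlinarith

/-- Changing the metric: `A ≼ c A'` gives `Tr(A'⁻¹ D) ≤ c Tr(A⁻¹ D)`. -/
lemma trace_inv_mul_le {A' D : Matrix (Fin d) (Fin d) ℝ} {c : ℝ} (hc : 0 < c) (hA : A.PosDef)
    (h : (c • A' - A).PosSemidef) (hD : D.PosSemidef) :
    (A'⁻¹ * D).trace ≤ c * (A⁻¹ * D).trace := by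
  have hB := posDef_of_posSemidef_sub h hA
  have h1 := trace_mul_nonneg (posSemidef_inv_sub_inv hA h) hD
  have h2 : (c • A')⁻¹ = c⁻¹ • A'⁻¹ := by
    have hA' : A'.PosDef := by
      have := hB.smul (inv_pos.2 hc)
      rwa [smul_smul, inv_mul_cancel₀ hc.ne', one_smul] at this
    have := inv_smul' (A := A') (Units.mk0 c hc.ne') ((isUnit_iff_isUnit_det A').1 hA'.isUnit)
    simpa [Units.smul_def] using this
  rw [h2, sub_mul, trace_sub, smul_mul, trace_smul, smul_eq_mul] at h1
  have h3 : c * (c⁻¹ * (A'⁻¹ * D).trace) = (A'⁻¹ * D).trace := by field_simp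
  rw [← h3]
  exact mul_le_mul_of_nonneg_left (by linarith) hc.le

end Form

/-! ### BFGS updates and the error `sigma` -/

section Bfgs

variable {d : ℕ} {A B : Matrix (Fin d) (Fin d) ℝ}

lemma mul_vecMulVec_mul (hB : B.IsHermitian) (u : Fin d → ℝ) :
    B * vecMulVec u u * B = vecMulVec (B *ᵥ u) (B *ᵥ u) := by
  have h : Bᵀ = B := by simpa using hB.eq
  rw [mul_vecMulVec, vecMulVec_mul, ← mulVec_transpose, h]

lemma bfgs_zero (B A : Matrix (Fin d) (Fin d) ℝ) : bfgs B A 0 = B := by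
  simp [bfgs]

lemma isHermitian_vecMulVec_self (v : Fin d → ℝ) : (vecMulVec v v).IsHermitian := by
  simpa using (posSemidef_vecMulVec_self_star v).isHermitian

lemma bfgs_isHermitian (hB : B.IsHermitian) (hA : A.IsHermitian) (u : Fin d → ℝ) :
    (bfgs B A u).IsHermitian := by
  rw [bfgs, mul_vecMulVec_mul hB, mul_vecMulVec_mul hA]
  exact (hB.sub ((isHermitian_vecMulVec_self _).smul (by simp [IsSelfAdjoint]))).add
    ((isHermitian_vecMulVec_self _).smul (by simp [IsSelfAdjoint]))

lemma form_bfgs (hB : B.IsHermitian) (hA : A.IsHermitian) (u v : Fin d → ℝ) :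
    v ⬝ᵥ bfgs B A u *ᵥ v = v ⬝ᵥ B *ᵥ v - (u ⬝ᵥ B *ᵥ u)⁻¹ * (u ⬝ᵥ B *ᵥ v) ^ 2 +
      (u ⬝ᵥ A *ᵥ u)⁻¹ * (u ⬝ᵥ A *ᵥ v) ^ 2 := by
  rw [bfgs, mul_vecMulVec_mul hB, mul_vecMulVec_mul hA]
  simp only [add_mulVec, sub_mulVec, smul_mulVec, vecMulVec_mulVec, dotProduct_add,
    dotProduct_sub, dotProduct_smul, smul_eq_mul, op_smul_eq_smul]
  rw [dotProduct_comm (B *ᵥ u) v, dotProduct_comm (A *ᵥ u) v, dot_mulVec_comm hB v u,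
    dot_mulVec_comm hA v u]
  ring

/-- The BFGS update preserves `A ≼ B`. -/
lemma bfgs_sub_posSemidef (hA : A.PosDef) (h : (B - A).PosSemidef) (u : Fin d → ℝ) :
    (bfgs B A u - A).PosSemidef := by
  have hB := posDef_of_posSemidef_sub h hA
  rcases eq_or_ne u 0 with rfl | hu
  · rwa [bfgs_zero]
  refine posSemidef_sub_of_form_le hA.isHermitian
    (bfgs_isHermitian hB.isHermitian hA.isHermitian u) fun v => ?_
  rw [form_bfgs hB.isHermitian hA.isHermitian]
  have hb := form_pos hB hu
  have ha := form_pos hA hu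
  set b := u ⬝ᵥ B *ᵥ u
  set a := u ⬝ᵥ A *ᵥ u
  -- The shift of `v` along `u` minimizes the `B`-form, producing the rank-one term subtracted from
  -- `B`; the `A`-form at the same shift is at least its own minimum, by the square in `h6`.
  have h1 := form_le h (v + (-(b⁻¹ * (u ⬝ᵥ B *ᵥ v))) • u)
  rw [form_add_smul hA.isHermitian, form_add_smul hB.isHermitian] at h1
  have h2 : b⁻¹ * b = 1 := inv_mul_cancel₀ hb.ne'
  have h3 : a⁻¹ * a = 1 := inv_mul_cancel₀ ha.ne'
  set p := u ⬝ᵥ B *ᵥ v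
  set q := u ⬝ᵥ A *ᵥ v
  set s := b⁻¹ * p with hs
  have h4 : s * b = p := by rw [hs, mul_right_comm, h2, one_mul]
  have h5 : b⁻¹ * p ^ 2 = s * p := by rw [hs]; ring
  have h6 : 0 ≤ a * (s - a⁻¹ * q) ^ 2 := by positivity
  have h7 : a * (s - a⁻¹ * q) ^ 2 = a * s ^ 2 - 2 * s * q + a⁻¹ * q ^ 2 := by
    linear_combination (-2 * s * q + a⁻¹ * q ^ 2) * h3
  have h8 : (-s) ^ 2 * b = s * p := by linear_combination s * h4
  change _ ≤ _ + 2 * -s * p + (-s) ^ 2 * b at h1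
  rw [h8] at h1
  rw [h5]
  nlinarith

lemma trace_inv_mul_bfgs (hB : B.IsHermitian) (hA : A.PosDef) {u : Fin d → ℝ} (hu : u ≠ 0) :
    (A⁻¹ * bfgs B A u).trace = (A⁻¹ * B).trace -
      ((u ⬝ᵥ B *ᵥ u)⁻¹ * ((B *ᵥ u) ⬝ᵥ A⁻¹ *ᵥ (B *ᵥ u)) - 1) := by
  have hdet : IsUnit A.det := (isUnit_iff_isUnit_det A).1 hA.isUnit
  rw [bfgs, mul_vecMulVec_mul hB, mul_vecMulVec_mul hA.isHermitian]
  simp only [mul_add, mul_sub, Matrix.mul_smul, trace_add, trace_sub, trace_smul, trace_mul_vecMulVec',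
    smul_eq_mul]
  rw [mulVec_mulVec u A⁻¹ A, nonsing_inv_mul A hdet, one_mulVec, dotProduct_comm (A *ᵥ u) u,
    inv_mul_cancel₀ (form_pos hA hu).ne']
  ring

lemma sigma_eq (hA : A.PosDef) : sigma B A = (A⁻¹ * (B - A)).trace := by
  have h : (A⁻¹)ᵀ = A⁻¹ := by simpa using hA.inv.isHermitian.eq
  rw [sigma, h]

lemma sigma_eq_trace_sub (hA : A.PosDef) : sigma B A = (A⁻¹ * B).trace - d := by
  have hdet : IsUnit A.det := (isUnit_iff_isUnit_det A).1 hA.isUnit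
  rw [sigma_eq hA, mul_sub, trace_sub, nonsing_inv_mul A hdet, trace_one, Fintype.card_fin]

/-- Scaling is linear on `sigma + d = Tr(A⁻¹ B)`, hence the pattern `w * (· + d) - d` in the later
bounds. -/
lemma sigma_smul (hA : A.PosDef) (w : ℝ) : sigma (w • B) A = w * (sigma B A + d) - d := by
  rw [sigma_eq_trace_sub hA, sigma_eq_trace_sub hA, Matrix.mul_smul, trace_smul, smul_eq_mul]
  ring

/-- The added rank-one term has trace 1 in the metric `A⁻¹`. Fenchel–Young for `B u` and `u`, with
`A ≼ B`, shows that the removed term has trace at least 1. -/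
lemma sigma_bfgs_le (hA : A.PosDef) (h : (B - A).PosSemidef) (u : Fin d → ℝ) :
    sigma (bfgs B A u) A ≤ sigma B A := by
  rcases eq_or_ne u 0 with rfl | hu
  · rw [bfgs_zero]
  have hB := posDef_of_posSemidef_sub h hA
  rw [sigma_eq_trace_sub hA, sigma_eq_trace_sub hA, trace_inv_mul_bfgs hB.isHermitian hA hu]
  have h1 := two_mul_dot_le hA (B *ᵥ u) u
  rw [dotProduct_comm (B *ᵥ u) u] at h1
  have h2 := form_le h u
  have h3 := form_pos hB hu
  have h4 : 1 ≤ (u ⬝ᵥ B *ᵥ u)⁻¹ * ((B *ᵥ u) ⬝ᵥ A⁻¹ *ᵥ (B *ᵥ u)) := by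
    rw [inv_mul_eq_div, le_div_iff₀ h3]
    linarith
  linarith

/-- The greedy update contracts `sigma` by the factor `1 - μ / (d L)`. -/
lemma sigma_bfgs_greedy_le {μ L : ℝ} (hμ : 0 < μ) (hL : 0 < L) (hA : A.PosDef)
    (h : (B - A).PosSemidef)
    (hAμ : ∀ v : Fin d → ℝ, μ * (v ⬝ᵥ v) ≤ v ⬝ᵥ A *ᵥ v)
    (hAL : ∀ v : Fin d → ℝ, v ⬝ᵥ A *ᵥ v ≤ L * (v ⬝ᵥ v))
    {u : Fin d → ℝ} (hu : IsGreedy B A u) :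
    sigma (bfgs B A u) A ≤ (1 - μ / (d * L)) * sigma B A := by
  obtain ⟨⟨k, rfl⟩, hmax⟩ := hu
  have hd : (0 : ℝ) < d := by exact_mod_cast k.pos
  set u : Fin d → ℝ := Pi.single k 1 with hudef
  have hu : u ≠ 0 := by simp [u]
  have hB := posDef_of_posSemidef_sub h hA
  have hb := form_pos hB hu
  have ha := form_pos hA hu
  set θ := (u ⬝ᵥ B *ᵥ u) / (u ⬝ᵥ A *ᵥ u) with hθ
  -- Fenchel–Young with `θ u`, the multiple for which `θ ⟨u, A u⟩ = ⟨u, B u⟩`.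
  have h1 : θ ≤ (u ⬝ᵥ B *ᵥ u)⁻¹ * ((B *ᵥ u) ⬝ᵥ A⁻¹ *ᵥ (B *ᵥ u)) := by
    have h2 := two_mul_dot_le hA (B *ᵥ u) (θ • u)
    simp only [mulVec_smul, dotProduct_smul, smul_dotProduct, smul_eq_mul] at h2
    rw [dotProduct_comm (B *ᵥ u) u] at h2
    have h3 : θ * (u ⬝ᵥ A *ᵥ u) = u ⬝ᵥ B *ᵥ u := by rw [hθ]; field_simp
    rw [h3] at h2
    rw [inv_mul_eq_div, le_div_iff₀ hb]
    linarith
  -- Greediness makes `θ` bound the ratio of all diagonal entries, so one direction controls the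
  -- whole trace of `B - A`.
  have hdiag : ∀ i, (B - A) i i ≤ L * (θ - 1) := by
    intro i
    set w : Fin d → ℝ := Pi.single i 1 with hw
    have h2 : (w ⬝ᵥ B *ᵥ w) / (w ⬝ᵥ A *ᵥ w) ≤ θ := hmax (Set.mem_range_self i)
    have hw0 : w ≠ 0 := by simp [w]
    have haw := form_pos hA hw0
    have hbw := form_le h w
    have hLw := hAL w
    have e1 : w ⬝ᵥ w = 1 := by simp [w]
    have e2 : (B - A) i i = w ⬝ᵥ B *ᵥ w - w ⬝ᵥ A *ᵥ w := by simp [w]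
    rw [div_le_iff₀ haw] at h2
    rw [e1, mul_one] at hLw
    have h4 : 1 ≤ θ := by
      by_contra hlt
      push Not at hlt
      nlinarith
    rw [e2]
    nlinarith
  have htr : (B - A).trace ≤ d * (L * (θ - 1)) := by
    calc (B - A).trace = ∑ i, (B - A) i i := rfl
      _ ≤ ∑ _i : Fin d, L * (θ - 1) := Finset.sum_le_sum fun i _ => hdiag i
      _ = d * (L * (θ - 1)) := by simp
  have hσ : μ * sigma B A ≤ (B - A).trace := by
    have h5 : (μ⁻¹ • A - 1).PosSemidef := by
      refine posSemidef_sub_of_form_le isHermitian_one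
        (hA.isHermitian.smul (by simp [IsSelfAdjoint])) fun v => ?_
      rw [smul_mulVec, one_mulVec, dotProduct_smul, smul_eq_mul, inv_mul_eq_div, le_div_iff₀ hμ]
      linarith [hAμ v]
    have h6 := trace_inv_mul_le (inv_pos.2 hμ) PosDef.one h5 h
    rw [← sigma_eq hA, inv_one, one_mul, inv_mul_eq_div, le_div_iff₀ hμ] at h6
    linarith
  have hθσ : μ / (d * L) * sigma B A ≤ θ - 1 := by
    rw [div_mul_eq_mul_div, div_le_iff₀ (by positivity)]
    linarith
  have := trace_inv_mul_bfgs hB.isHermitian hA hu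
  have e : sigma (bfgs B A u) A ≤ sigma B A - (θ - 1) := by
    rw [sigma_eq_trace_sub hA, sigma_eq_trace_sub hA, this]
    linarith
  linarith

lemma trace_sub_le_sigma {L : ℝ} (hL : 0 < L) (hA : A.PosDef) (h : (B - A).PosSemidef)
    (hAL : ∀ v : Fin d → ℝ, v ⬝ᵥ A *ᵥ v ≤ L * (v ⬝ᵥ v)) :
    (B - A).trace ≤ L * sigma B A := by
  have h5 : (L • (1 : Matrix (Fin d) (Fin d) ℝ) - A).PosSemidef := by
    refine posSemidef_sub_of_form_le hA.isHermitian
      (isHermitian_one.smul (by simp [IsSelfAdjoint])) fun v => ?_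
    rw [smul_mulVec, one_mulVec, dotProduct_smul, smul_eq_mul]
    exact hAL v
  have h6 := trace_inv_mul_le hL hA h5 h
  rwa [← sigma_eq hA, inv_one, one_mul] at h6

end Bfgs

/-! ### Hessians, averaged Hessians and the gradient's Taylor remainder -/

section Hessian

variable {d : ℕ} {f : EuclideanSpace ℝ (Fin d) → ℝ} {μ L Lt : ℝ}

lemma gradient_eq_comp (f : EuclideanSpace ℝ (Fin d) → ℝ) :
    gradient f = (InnerProductSpace.toDual ℝ (EuclideanSpace ℝ (Fin d))).symm ∘ fderiv ℝ f := rfl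

lemma differentiable_gradient (hf : ContDiff ℝ 2 f) : Differentiable ℝ (gradient f) := by
  rw [gradient_eq_comp]
  exact (LinearIsometryEquiv.differentiable _).comp
    ((hf.fderiv_right (m := 1) (by norm_num)).differentiable (by norm_num))

lemma inner_hessOp (hf : ContDiff ℝ 2 f) (x v w : EuclideanSpace ℝ (Fin d)) :
    inner ℝ (hessOp f x w) v = fderiv ℝ (fderiv ℝ f) x w v := by
  have h : DifferentiableAt ℝ (fderiv ℝ f) x :=
    (hf.fderiv_right (m := 1) (by norm_num)).differentiable (by norm_num) x
  have e : hessOp f x w = (InnerProductSpace.toDual ℝ (EuclideanSpace ℝ (Fin d))).symm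
      (fderiv ℝ (fderiv ℝ f) x w) := by
    rw [hessOp, gradient_eq_comp]
    rw [LinearIsometryEquiv.comp_fderiv']
    rfl
  rw [e, InnerProductSpace.toDual_symm_apply]

lemma inner_hessOp_comm (hf : ContDiff ℝ 2 f) (x v w : EuclideanSpace ℝ (Fin d)) :
    inner ℝ (hessOp f x w) v = inner ℝ (hessOp f x v) w := by
  rw [inner_hessOp hf, inner_hessOp hf]
  exact (hf.contDiffAt.isSymmSndFDerivAt (by simp)).eq w v

lemma hess_mulVec (f : EuclideanSpace ℝ (Fin d) → ℝ) (x v : EuclideanSpace ℝ (Fin d)) :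
    hess f x *ᵥ v.ofLp = (hessOp f x v).ofLp := by
  rw [← ofLp_toEuclideanCLM, hess, StarAlgEquiv.apply_symm_apply]

lemma dot_hess (f : EuclideanSpace ℝ (Fin d) → ℝ) (x v w : EuclideanSpace ℝ (Fin d)) :
    v.ofLp ⬝ᵥ hess f x *ᵥ w.ofLp = inner ℝ (hessOp f x w) v := by
  rw [hess_mulVec, EuclideanSpace.inner_eq_star_dotProduct, star_trivial]

lemma dot_self_ofLp (v : EuclideanSpace ℝ (Fin d)) : v.ofLp ⬝ᵥ v.ofLp = ‖v‖ ^ 2 := by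
  rw [← real_inner_self_eq_norm_sq, EuclideanSpace.inner_eq_star_dotProduct, star_trivial]

lemma hess_apply (f : EuclideanSpace ℝ (Fin d) → ℝ) (x : EuclideanSpace ℝ (Fin d))
    (i j : Fin d) : hess f x i j = inner ℝ (hessOp f x (EuclideanSpace.single j 1))
      (EuclideanSpace.single i 1) := by
  rw [← dot_hess]
  simp

lemma hess_isHermitian (hf : ContDiff ℝ 2 f) (x : EuclideanSpace ℝ (Fin d)) :
    (hess f x).IsHermitian := by
  ext i j
  rw [conjTranspose_apply, star_trivial, hess_apply, hess_apply, inner_hessOp_comm hf]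

lemma continuous_hessOp (hf : ContDiff ℝ 2 f) : Continuous (hessOp f) := by
  have h : ContDiff ℝ 1 (gradient f) := by
    rw [gradient_eq_comp]
    exact (LinearIsometryEquiv.contDiff _).comp (hf.fderiv_right (m := 1) (by norm_num))
  exact h.continuous_fderiv (by norm_num)

/-- Lets bounds on gradient differences pass to the Hessian form in the limit. -/
lemma slope_gradient_tendsto (hf : ContDiff ℝ 2 f) (x v : EuclideanSpace ℝ (Fin d)) :
    Filter.Tendsto (fun s : ℝ => s⁻¹ * inner ℝ (gradient f (x + s • v) - gradient f x) v)
      (nhdsWithin 0 {0}ᶜ) (nhds (inner ℝ (hessOp f x v) v)) := by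
  have h1 : HasDerivAt (fun s : ℝ => x + s • v) v 0 := by
    simpa using ((hasDerivAt_id (0 : ℝ)).smul_const v).const_add x
  have h2 : HasFDerivAt (gradient f) (hessOp f x) (x + (0 : ℝ) • v) := by
    rw [zero_smul, add_zero]
    exact (differentiable_gradient hf x).hasFDerivAt
  have h3 := h2.comp_hasDerivAt (0 : ℝ) h1
  have h4 := (h3.inner ℝ (hasDerivAt_const (0 : ℝ) v))
  rw [hasDerivAt_iff_tendsto_slope] at h4
  simp only [inner_zero_right, zero_add] at h4
  refine h4.congr fun s => ?_
  simp [slope_def_field, inner_sub_left, div_eq_inv_mul]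

lemma inner_gradient_sub_ge (h : StronglyConvex μ f) (x y : EuclideanSpace ℝ (Fin d)) :
    μ * ‖y - x‖ ^ 2 ≤ inner ℝ (gradient f y - gradient f x) (y - x) := by
  have h1 := h x y
  have h2 := h y x
  rw [norm_sub_rev x y, ← neg_sub y x, inner_neg_right] at h2
  rw [inner_sub_left]
  linarith

lemma inner_gradient_sub_le (h : Smooth L f) (x y : EuclideanSpace ℝ (Fin d)) :
    inner ℝ (gradient f y - gradient f x) (y - x) ≤ L * ‖y - x‖ ^ 2 := by
  have h1 := h x y
  have h2 := h y x
  rw [norm_sub_rev x y, ← neg_sub y x, inner_neg_right] at h2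
  rw [inner_sub_left]
  linarith

lemma inner_hessOp_self_ge (hf : ContDiff ℝ 2 f) (h : StronglyConvex μ f)
    (x v : EuclideanSpace ℝ (Fin d)) : μ * ‖v‖ ^ 2 ≤ inner ℝ (hessOp f x v) v := by
  refine ge_of_tendsto (slope_gradient_tendsto hf x v) ?_
  filter_upwards [self_mem_nhdsWithin] with s hs
  have hs : s ≠ 0 := hs
  have h1 := inner_gradient_sub_ge h x (x + s • v)
  rw [add_sub_cancel_left, inner_smul_right, norm_smul, mul_pow, Real.norm_eq_abs, sq_abs] at h1
  have h2 : s⁻¹ * inner ℝ (gradient f (x + s • v) - gradient f x) v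
      = (s * inner ℝ (gradient f (x + s • v) - gradient f x) v) / s ^ 2 := by field_simp
  rw [h2, le_div_iff₀ (by positivity)]
  linarith

lemma inner_hessOp_self_le (hf : ContDiff ℝ 2 f) (h : Smooth L f)
    (x v : EuclideanSpace ℝ (Fin d)) : inner ℝ (hessOp f x v) v ≤ L * ‖v‖ ^ 2 := by
  refine le_of_tendsto (slope_gradient_tendsto hf x v) ?_
  filter_upwards [self_mem_nhdsWithin] with s hs
  have hs : s ≠ 0 := hs
  have h1 := inner_gradient_sub_le h x (x + s • v)
  rw [add_sub_cancel_left, inner_smul_right, norm_smul, mul_pow, Real.norm_eq_abs, sq_abs] at h1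
  have h2 : s⁻¹ * inner ℝ (gradient f (x + s • v) - gradient f x) v
      = (s * inner ℝ (gradient f (x + s • v) - gradient f x) v) / s ^ 2 := by field_simp
  rw [h2, div_le_iff₀ (by positivity)]
  linarith

lemma form_hess_ge (hf : ContDiff ℝ 2 f) (h : StronglyConvex μ f) (x : EuclideanSpace ℝ (Fin d))
    (v : Fin d → ℝ) : μ * (v ⬝ᵥ v) ≤ v ⬝ᵥ hess f x *ᵥ v := by
  have := inner_hessOp_self_ge hf h x (WithLp.toLp 2 v)
  rwa [← dot_hess, ← dot_self_ofLp] at this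

lemma form_hess_le (hf : ContDiff ℝ 2 f) (h : Smooth L f) (x : EuclideanSpace ℝ (Fin d))
    (v : Fin d → ℝ) : v ⬝ᵥ hess f x *ᵥ v ≤ L * (v ⬝ᵥ v) := by
  have := inner_hessOp_self_le hf h x (WithLp.toLp 2 v)
  rwa [← dot_hess, ← dot_self_ofLp] at this

lemma hess_posDef (hf : ContDiff ℝ 2 f) (hμ : 0 < μ) (h : StronglyConvex μ f)
    (x : EuclideanSpace ℝ (Fin d)) : (hess f x).PosDef :=
  posDef_of_form_le (hess_isHermitian hf x) hμ (form_hess_ge hf h x)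

lemma abs_form_hess_sub_le (h : LipschitzHessian Lt f) (x y : EuclideanSpace ℝ (Fin d))
    (v : Fin d → ℝ) :
    |v ⬝ᵥ hess f y *ᵥ v - v ⬝ᵥ hess f x *ᵥ v| ≤ Lt * ‖y - x‖ * (v ⬝ᵥ v) := by
  have e : v = (WithLp.toLp 2 v : EuclideanSpace ℝ (Fin d)).ofLp := rfl
  rw [e, dot_hess, dot_hess, dot_self_ofLp, ← inner_sub_left, ← _root_.sub_apply]
  set w : EuclideanSpace ℝ (Fin d) := WithLp.toLp 2 v
  calc |inner ℝ ((hessOp f y - hessOp f x) w) w| ≤ ‖(hessOp f y - hessOp f x) w‖ * ‖w‖ :=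
        abs_real_inner_le_norm _ _
    _ ≤ (‖hessOp f y - hessOp f x‖ * ‖w‖) * ‖w‖ := by
        gcongr
        exact ContinuousLinearMap.le_opNorm _ _
    _ ≤ (Lt * ‖y - x‖ * ‖w‖) * ‖w‖ := by
        gcongr
        exact h x y
    _ = _ := by ring

lemma continuous_hess_apply (hf : ContDiff ℝ 2 f) (x y : EuclideanSpace ℝ (Fin d))
    (i j : Fin d) : Continuous fun τ : ℝ => hess f (x + τ • (y - x)) i j := by
  simp only [hess_apply]
  have := continuous_hessOp hf
  fun_prop

lemma avgHess_isHermitian (hf : ContDiff ℝ 2 f) (x y : EuclideanSpace ℝ (Fin d)) :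
    (avgHess f x y).IsHermitian := by
  ext i j
  rw [conjTranspose_apply, star_trivial]
  simp only [avgHess, of_apply]
  congr 1
  ext τ
  simpa using (hess_isHermitian hf (x + τ • (y - x))).apply i j

lemma form_eq_sum (A : Matrix (Fin d) (Fin d) ℝ) (v : Fin d → ℝ) :
    v ⬝ᵥ A *ᵥ v = ∑ i, ∑ j, A i j * (v i * v j) := by
  simp only [dotProduct, mulVec, Finset.mul_sum]
  refine Finset.sum_congr rfl fun i _ => Finset.sum_congr rfl fun j _ => by ring

lemma continuous_form_hess (hf : ContDiff ℝ 2 f) (x y : EuclideanSpace ℝ (Fin d))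
    (v : Fin d → ℝ) :
    Continuous fun τ : ℝ => v ⬝ᵥ hess f (x + τ • (y - x)) *ᵥ v := by
  simp only [form_eq_sum]
  exact continuous_finsetSum _ fun i _ => continuous_finsetSum _ fun j _ =>
    (continuous_hess_apply hf x y i j).mul continuous_const

lemma form_avgHess (hf : ContDiff ℝ 2 f) (x y : EuclideanSpace ℝ (Fin d)) (v : Fin d → ℝ) :
    v ⬝ᵥ avgHess f x y *ᵥ v = ∫ τ in (0 : ℝ)..1, v ⬝ᵥ hess f (x + τ • (y - x)) *ᵥ v := by
  have hc : ∀ i j, Continuous fun τ : ℝ => hess f (x + τ • (y - x)) i j * (v i * v j) :=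
    fun i j => (continuous_hess_apply hf x y i j).mul continuous_const
  have hr : ∀ i, Continuous fun τ : ℝ => ∑ j, hess f (x + τ • (y - x)) i j * (v i * v j) :=
    fun i => continuous_finsetSum _ fun j _ => hc i j
  simp only [form_eq_sum]
  rw [intervalIntegral.integral_finsetSum fun i _ => (hr i).intervalIntegrable _ _]
  refine Finset.sum_congr rfl fun i _ => ?_
  rw [intervalIntegral.integral_finsetSum fun j _ => (hc i j).intervalIntegrable _ _]
  refine Finset.sum_congr rfl fun j _ => ?_
  rw [intervalIntegral.integral_mul_const]
  rfl

lemma form_avgHess_ge (hf : ContDiff ℝ 2 f) (h : StronglyConvex μ f)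
    (x y : EuclideanSpace ℝ (Fin d)) (v : Fin d → ℝ) :
    μ * (v ⬝ᵥ v) ≤ v ⬝ᵥ avgHess f x y *ᵥ v := by
  rw [form_avgHess hf]
  have : ∫ _τ in (0 : ℝ)..1, μ * (v ⬝ᵥ v) = μ * (v ⬝ᵥ v) := by simp
  rw [← this]
  exact intervalIntegral.integral_mono_on (by norm_num) (by simp)
    ((continuous_form_hess hf x y v).intervalIntegrable _ _) fun τ _ => form_hess_ge hf h _ v

lemma avgHess_posDef (hf : ContDiff ℝ 2 f) (hμ : 0 < μ) (h : StronglyConvex μ f)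
    (x y : EuclideanSpace ℝ (Fin d)) : (avgHess f x y).PosDef :=
  posDef_of_form_le (avgHess_isHermitian hf x y) hμ (form_avgHess_ge hf h x y)

/-- The bound may depend on `τ`: integrating the weights `τ` and `1 - τ` yields the factor 1/2 in
the next two lemmas. -/
lemma abs_form_avgHess_sub_le (hf : ContDiff ℝ 2 f) {x y : EuclideanSpace ℝ (Fin d)}
    {v : Fin d → ℝ} {c : ℝ} {g : ℝ → ℝ} (hg : Continuous g)
    (h : ∀ τ ∈ Set.Ioc (0 : ℝ) 1, |v ⬝ᵥ hess f (x + τ • (y - x)) *ᵥ v - c| ≤ g τ) :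
    |v ⬝ᵥ avgHess f x y *ᵥ v - c| ≤ ∫ τ in (0 : ℝ)..1, g τ := by
  have e : v ⬝ᵥ avgHess f x y *ᵥ v - c
      = ∫ τ in (0 : ℝ)..1, (v ⬝ᵥ hess f (x + τ • (y - x)) *ᵥ v - c) := by
    rw [intervalIntegral.integral_sub ((continuous_form_hess hf x y v).intervalIntegrable _ _)
      (by simp), form_avgHess hf]
    simp
  rw [e, ← Real.norm_eq_abs]
  refine intervalIntegral.norm_integral_le_of_norm_le (by norm_num) ?_
    (hg.intervalIntegrable _ _)
  exact Filter.Eventually.of_forall fun τ hτ => h τ hτ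

lemma abs_form_avgHess_sub_left_le (hf : ContDiff ℝ 2 f) (h : LipschitzHessian Lt f)
    (x y : EuclideanSpace ℝ (Fin d)) (v : Fin d → ℝ) :
    |v ⬝ᵥ avgHess f x y *ᵥ v - v ⬝ᵥ hess f x *ᵥ v| ≤ Lt * ‖y - x‖ / 2 * (v ⬝ᵥ v) := by
  have h1 := abs_form_avgHess_sub_le hf (x := x) (y := y) (v := v) (c := v ⬝ᵥ hess f x *ᵥ v)
    (g := fun τ => τ * (Lt * ‖y - x‖ * (v ⬝ᵥ v))) (by fun_prop) (by
      intro τ hτ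
      refine (abs_form_hess_sub_le h x _ v).trans_eq ?_
      rw [add_sub_cancel_left, norm_smul, Real.norm_of_nonneg hτ.1.le]
      ring)
  refine h1.trans_eq ?_
  rw [intervalIntegral.integral_mul_const, integral_id]
  ring

lemma abs_form_avgHess_sub_right_le (hf : ContDiff ℝ 2 f) (h : LipschitzHessian Lt f)
    (x y : EuclideanSpace ℝ (Fin d)) (v : Fin d → ℝ) :
    |v ⬝ᵥ avgHess f x y *ᵥ v - v ⬝ᵥ hess f y *ᵥ v| ≤ Lt * ‖y - x‖ / 2 * (v ⬝ᵥ v) := by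
  have h1 := abs_form_avgHess_sub_le hf (x := x) (y := y) (v := v) (c := v ⬝ᵥ hess f y *ᵥ v)
    (g := fun τ => (1 - τ) * (Lt * ‖y - x‖ * (v ⬝ᵥ v))) (by fun_prop) (by
      intro τ hτ
      refine (abs_form_hess_sub_le h y _ v).trans_eq ?_
      have e : x + τ • (y - x) - y = (-(1 - τ)) • (y - x) := by module
      rw [e, norm_smul, norm_neg, Real.norm_of_nonneg (by linarith [hτ.2])]
      ring)
  refine h1.trans_eq ?_
  rw [intervalIntegral.integral_mul_const,
    intervalIntegral.integral_sub (by simp) (by simp), integral_id]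
  simp
  ring

lemma norm_gradient_taylor_le (hf : ContDiff ℝ 2 f) (hLt : 0 ≤ Lt) (h : LipschitzHessian Lt f)
    (x y : EuclideanSpace ℝ (Fin d)) :
    ‖gradient f y - gradient f x - hessOp f x (y - x)‖ ≤ Lt * ‖y - x‖ * ‖y - x‖ := by
  refine (convex_segment x y).norm_image_sub_le_of_norm_fderiv_le'
    (fun z _ => differentiable_gradient hf z) (fun z hz => ?_)
    (left_mem_segment ℝ x y) (right_mem_segment ℝ x y)
  refine (h x z).trans ?_
  gcongr
  obtain ⟨θ, hθ, rfl⟩ := (segment_eq_image' ℝ x y ▸ hz)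
  simp only [add_sub_cancel_left, norm_smul, Real.norm_of_nonneg hθ.1]
  nlinarith [norm_nonneg (y - x), hθ.2]

lemma sum_gradient_eq_zero {n : ℕ} [NeZero n] {f : Fin n → EuclideanSpace ℝ (Fin d) → ℝ}
    (hf : ∀ i, ContDiff ℝ 2 (f i)) {xs : EuclideanSpace ℝ (Fin d)}
    (hxs : IsMinOn (fun y => (1 / (n : ℝ)) * ∑ i, f i y) Set.univ xs) :
    ∑ i, gradient (f i) xs = 0 := by
  have hd : ∀ i, DifferentiableAt ℝ (f i) xs := fun i => (hf i).differentiable (by norm_num) xs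
  have h1 : IsMinOn (fun y => ∑ i, f i y) Set.univ xs := by
    intro y hy
    have h2 : (1 / (n : ℝ)) * ∑ i, f i xs ≤ (1 / (n : ℝ)) * ∑ i, f i y := hxs hy
    have hn : (0 : ℝ) < 1 / n := by
      have : (0 : ℝ) < n := by exact_mod_cast NeZero.pos n
      positivity
    exact le_of_mul_le_mul_left h2 hn
  have h3 : fderiv ℝ (fun y => ∑ i, f i y) xs = 0 :=
    (h1.isLocalMin Filter.univ_mem).fderiv_eq_zero
  rw [fderiv_fun_sum fun i _ => hd i] at h3
  have h4 : ∀ i, gradient (f i) xs = (InnerProductSpace.toDual ℝ (EuclideanSpace ℝ (Fin d))).symm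
      (fderiv ℝ (f i) xs) := fun _ => rfl
  simp only [h4]
  rw [← map_sum, h3, map_zero]

end Hessian

/-! ### One iteration: matrix update and point update -/

section Step

variable {d : ℕ} {μ L Lt : ℝ}

/-- An additive error `a μ |v|²` is absorbed by `a B`, since `B ≽ μ I`. -/
lemma posSemidef_smul_sub {A B : Matrix (Fin d) (Fin d) ℝ} (hA : A.IsHermitian)
    (hB : B.IsHermitian) {a μ : ℝ} (ha : 0 ≤ a) (hBμ : ∀ v : Fin d → ℝ, μ * (v ⬝ᵥ v) ≤ v ⬝ᵥ B *ᵥ v)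
    (h : ∀ v : Fin d → ℝ, v ⬝ᵥ A *ᵥ v ≤ v ⬝ᵥ B *ᵥ v + a * μ * (v ⬝ᵥ v)) :
    ((1 + a) • B - A).PosSemidef := by
  refine posSemidef_sub_of_form_le hA (hB.smul (by simp [IsSelfAdjoint])) fun v => ?_
  rw [smul_mulVec, dotProduct_smul, smul_eq_mul]
  nlinarith [h v, mul_le_mul_of_nonneg_left (hBμ v) ha]

/-- The first update of an iteration: the corrected averaged Hessian `(1 + a) K` lies between
the scaled old Hessian and the new one, so the update stays above the new Hessian. -/
lemma bfgs_avgHess {f : EuclideanSpace ℝ (Fin d) → ℝ} (hf : ContDiff ℝ 2 f) (hμ : 0 < μ)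
    (hconv : StronglyConvex μ f) (hlip : LipschitzHessian Lt f)
    {a s : ℝ} (ha : 0 ≤ a) {z z' : EuclideanSpace ℝ (Fin d)}
    (hz : Lt * ‖z' - z‖ ≤ 2 * (a * μ)) {D : Matrix (Fin d) (Fin d) ℝ}
    (hD : (D - (1 + a) ^ 2 • hess f z).PosSemidef) (hs : sigma D (hess f z) ≤ s)
    (v : Fin d → ℝ) :
    (bfgs D ((1 + a) • avgHess f z z') v).PosDef ∧
    (bfgs D ((1 + a) • avgHess f z z') v - hess f z').PosSemidef ∧
    sigma (bfgs D ((1 + a) • avgHess f z z') v) (hess f z') ≤ (1 + a) ^ 2 * (s + d) - d := by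
  set K := avgHess f z z'
  set H := hess f z
  set H' := hess f z'
  have hK : K.PosDef := avgHess_posDef hf hμ hconv z z'
  have hH : H.PosDef := hess_posDef hf hμ hconv z
  have hH' : H'.PosDef := hess_posDef hf hμ hconv z'
  have hKμ := form_avgHess_ge hf hconv z z'
  have hHμ := form_hess_ge hf hconv z
  have hHμ' := form_hess_ge hf hconv z'
  have ha1 : 0 < 1 + a := by linarith
  have hbound : ∀ w : Fin d → ℝ, Lt * ‖z' - z‖ / 2 * (w ⬝ᵥ w) ≤ a * μ * (w ⬝ᵥ w) := fun w =>
    mul_le_mul_of_nonneg_right (by linarith) (by simpa using dotProduct_star_self_nonneg w)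
  have hl := fun w => abs_le.1 ((abs_form_avgHess_sub_left_le hf hlip z z' w).trans (hbound w))
  have hr := fun w => abs_le.1 ((abs_form_avgHess_sub_right_le hf hlip z z' w).trans (hbound w))
  have h1 : ((1 + a) • H - K).PosSemidef :=
    posSemidef_smul_sub hK.isHermitian hH.isHermitian ha hHμ fun w => by linarith [(hl w).2]
  have h2 : ((1 + a) • K - H).PosSemidef :=
    posSemidef_smul_sub hH.isHermitian hK.isHermitian ha hKμ fun w => by linarith [(hl w).1]
  have h3 : ((1 + a) • H' - K).PosSemidef :=
    posSemidef_smul_sub hK.isHermitian hH'.isHermitian ha hHμ' fun w => by linarith [(hr w).2]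
  have h4 : ((1 + a) • K - H').PosSemidef :=
    posSemidef_smul_sub hH'.isHermitian hK.isHermitian ha hKμ fun w => by linarith [(hr w).1]
  have hA : ((1 + a) • K).PosDef := hK.smul ha1
  have hDA : (D - (1 + a) • K).PosSemidef := by
    have := hD.add (h1.smul ha1.le)
    convert this using 1
    module
  have hQA := bfgs_sub_posSemidef hA hDA v
  have hQ := posDef_of_posSemidef_sub hQA hA
  have hQH : (bfgs D ((1 + a) • K) v - H').PosSemidef := by simpa using hQA.add h4
  refine ⟨hQ, hQH, ?_⟩
  have hDpos := posDef_of_posSemidef_sub hDA hA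
  have e1 := sigma_bfgs_le hA hDA v
  -- Passing from the metric `H` to `(1 + a) K` is free because `H ≼ (1 + a) K`; passing on to `H'`
  -- costs `(1 + a)^2`.
  have e2 := trace_inv_mul_le one_pos hH (A' := (1 + a) • K) (by simpa using h2) hDpos.posSemidef
  have e3 := trace_inv_mul_le (A' := H') (c := (1 + a) ^ 2) (by positivity) hA (by
    convert h3.smul ha1.le using 1
    module) hQ.posSemidef
  rw [sigma_eq_trace_sub hH] at hs
  rw [sigma_eq_trace_sub hA, sigma_eq_trace_sub hA] at e1
  rw [sigma_eq_trace_sub hH']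
  have e4 : (((1 + a) • K)⁻¹ * bfgs D ((1 + a) • K) v).trace ≤ s + d := by linarith
  have := mul_le_mul_of_nonneg_left e4 (sq_nonneg (1 + a))
  linarith

/-- One step of the incremental quasi-Newton iteration. -/
lemma norm_step_le {n : ℕ} [NeZero n] {f : Fin n → EuclideanSpace ℝ (Fin d) → ℝ}
    (hμ : 0 < μ) (hL : 0 < L) (hLt : 0 ≤ Lt) (hf : ∀ i, ContDiff ℝ 2 (f i))
    (hconv : ∀ i, StronglyConvex μ (f i)) (hsmooth : ∀ i, Smooth L (f i))
    (hlip : ∀ i, LipschitzHessian Lt (f i)) {xs x : EuclideanSpace ℝ (Fin d)}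
    (hgrad : ∑ i, gradient (f i) xs = 0)
    {D : Fin n → Matrix (Fin d) (Fin d) ℝ} {z : Fin n → EuclideanSpace ℝ (Fin d)} {b R : ℝ}
    (hD : ∀ i, (D i - hess (f i) (z i)).PosSemidef)
    (hσ : ∀ i, sigma (D i) (hess (f i) (z i)) ≤ b) (hz : ∀ i, ‖z i - xs‖ ≤ R)
    (hx : x.ofLp = (∑ i, D i)⁻¹ *ᵥ (∑ i, (D i *ᵥ (z i).ofLp - (gradient (f i) (z i)).ofLp))) :
    ‖x - xs‖ ≤ 1 / μ * (L * b + Lt * R) * ((1 / (n : ℝ)) * ∑ i, ‖z i - xs‖) := by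
  have hn : (0 : ℝ) < n := by exact_mod_cast NeZero.pos n
  have hH := fun i => hess_posDef (hf i) hμ (hconv i) (z i)
  have hDpos := fun i => posDef_of_posSemidef_sub (hD i) (hH i)
  -- The residual splits into the Hessian approximation error and the Taylor remainder; up to
  -- `∇f_i(xs)`, which sums to zero, it is the `i`-th term of `(∑ D i)(x - xs)`.
  set r : Fin n → EuclideanSpace ℝ (Fin d) := fun i =>
    WithLp.toLp 2 ((D i - hess (f i) (z i)) *ᵥ (z i - xs).ofLp) +
      (gradient (f i) xs - gradient (f i) (z i) - hessOp (f i) (z i) (xs - z i)) with hr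
  have hrnorm : ∀ i, ‖r i‖ ≤ (L * b + Lt * R) * ‖z i - xs‖ := by
    intro i
    have h1 : ‖(WithLp.toLp 2 ((D i - hess (f i) (z i)) *ᵥ (z i - xs).ofLp) :
        EuclideanSpace ℝ (Fin d))‖ ≤ L * b * ‖z i - xs‖ := by
      have htr : (D i - hess (f i) (z i)).trace ≤ L * b :=
        (trace_sub_le_sigma hL (hH i) (hD i) (form_hess_le (hf i) (hsmooth i) (z i))).trans
          (mul_le_mul_of_nonneg_left (hσ i) hL.le)
      have htr0 := (hD i).trace_nonneg
      have h2 := mulVec_dot_mulVec_le (hD i) (z i - xs).ofLp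
      rw [dot_self_ofLp (z i - xs), ← mul_pow] at h2
      have h3 := dot_self_ofLp (WithLp.toLp 2 ((D i - hess (f i) (z i)) *ᵥ (z i - xs).ofLp))
      exact (le_of_abs_le (abs_le_of_sq_le_sq (h3.symm.trans_le h2) (by positivity))).trans
        (mul_le_mul_of_nonneg_right htr (norm_nonneg _))
    have h4 := norm_gradient_taylor_le (hf i) hLt (hlip i) (z i) xs
    rw [norm_sub_rev xs (z i)] at h4
    have h5 : Lt * ‖z i - xs‖ * ‖z i - xs‖ ≤ Lt * R * ‖z i - xs‖ := by
      gcongr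
      exact hz i
    refine (norm_add_le _ _).trans ?_
    linarith
  have hS : (∑ i, D i).PosDef := by
    refine posDef_sum Finset.univ_nonempty fun i _ => hDpos i
  have hdet : IsUnit (∑ i, D i).det := (isUnit_iff_isUnit_det _).1 hS.isUnit
  have hSw : (∑ i, D i) *ᵥ (x - xs).ofLp = (∑ i, r i).ofLp := by
    have e1 : (x - xs).ofLp = x.ofLp - xs.ofLp := rfl
    have e2 : ∑ i, r i = ∑ i, (r i - gradient (f i) xs) := by
      rw [Finset.sum_sub_distrib, hgrad, sub_zero]
    rw [e1, mulVec_sub, hx, mulVec_mulVec, mul_nonsing_inv _ hdet, one_mulVec, sum_mulVec,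
      ← Finset.sum_sub_distrib, e2, WithLp.ofLp_sum]
    refine Finset.sum_congr rfl fun i _ => ?_
    simp only [hr, WithLp.ofLp_sub, WithLp.ofLp_add, sub_mulVec, mulVec_sub, map_sub,
      ← hess_mulVec]
    abel
  have hform : n * μ * ‖x - xs‖ ^ 2 ≤ (x - xs).ofLp ⬝ᵥ (∑ i, D i) *ᵥ (x - xs).ofLp := by
    rw [sum_mulVec, dotProduct_sum, ← dot_self_ofLp]
    have : (n : ℝ) * μ * ((x - xs).ofLp ⬝ᵥ (x - xs).ofLp)
        = ∑ _i : Fin n, μ * ((x - xs).ofLp ⬝ᵥ (x - xs).ofLp) := by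
      simp [mul_assoc]
    rw [this]
    exact Finset.sum_le_sum fun i _ =>
      (form_hess_ge (hf i) (hconv i) (z i) _).trans (form_le (hD i) _)
  have hcs : (x - xs).ofLp ⬝ᵥ (∑ i, D i) *ᵥ (x - xs).ofLp ≤
      ‖x - xs‖ * ((L * b + Lt * R) * ∑ i, ‖z i - xs‖) := by
    rw [hSw]
    have e : (x - xs).ofLp ⬝ᵥ (∑ i, r i).ofLp = inner ℝ (∑ i, r i) (x - xs) := by
      rw [EuclideanSpace.inner_eq_star_dotProduct, star_trivial]
    rw [e]
    refine (real_inner_le_norm _ _).trans ?_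
    rw [mul_comm]
    refine mul_le_mul_of_nonneg_left ((norm_sum_le _ _).trans ?_) (norm_nonneg _)
    rw [Finset.mul_sum]
    exact Finset.sum_le_sum fun i _ => hrnorm i
  have hsum : 0 ≤ (L * b + Lt * R) * ∑ i, ‖z i - xs‖ := by
    rw [Finset.mul_sum]
    exact Finset.sum_nonneg fun i _ => (norm_nonneg _).trans (hrnorm i)
  have key : n * μ * ‖x - xs‖ ≤ (L * b + Lt * R) * ∑ i, ‖z i - xs‖ := by
    rcases (norm_nonneg (x - xs)).eq_or_lt with h | h
    · rw [← h, mul_zero]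
      exact hsum
    · refine le_of_mul_le_mul_left ?_ h
      nlinarith
  have e : 1 / μ * (L * b + Lt * R) * ((1 / (n : ℝ)) * ∑ i, ‖z i - xs‖)
      = ((L * b + Lt * R) * ∑ i, ‖z i - xs‖) / (n * μ) := by
    field_simp
  rw [e, le_div_iff₀ (by positivity)]
  linarith

end Step

/-! ### Cyclic indexing and epochs -/

section Index

variable {n : ℕ} [NeZero n]

lemma idx_add_ne {s k : ℕ} (hs : 1 ≤ s) (hk : 0 < k) (hkn : k < n) :
    idx n s ≠ idx n (s + k) := by
  intro h
  have h1 : (s - 1) % n = (s + k - 1) % n := congrArg Fin.val h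
  have h2 : n ∣ (s + k - 1) - (s - 1) := (Nat.modEq_iff_dvd' (by lia)).1 h1
  have h3 : (s + k - 1) - (s - 1) = k := by lia
  rw [h3] at h2
  exact absurd (Nat.le_of_dvd hk h2) (by lia)

variable {X : Type*} {x : ℕ → X} {z : ℕ → Fin n → X}

lemma cyclic_hold (hact : ∀ t, 1 ≤ t → z t (idx n t) = x t)
    (hrest : ∀ t, 1 ≤ t → ∀ i, i ≠ idx n t → z t i = z (t - 1) i) {s : ℕ} (hs : 1 ≤ s) (k : ℕ)
    (hk : k < n) : z (s + k) (idx n s) = x s := by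
  induction k with
  | zero => exact hact s hs
  | succ k ih =>
    rw [hrest (s + (k + 1)) (by lia) _ (idx_add_ne hs k.succ_pos hk)]
    exact ih (by lia)

lemma cyclic_init (hinit : ∀ i, z 0 i = x 0)
    (hrest : ∀ t, 1 ≤ t → ∀ i, i ≠ idx n t → z t i = z (t - 1) i) (t : ℕ) (i : Fin n)
    (h : t ≤ i.val) : z t i = x 0 := by
  induction t with
  | zero => exact hinit i
  | succ t ih =>
    rw [hrest (t + 1) (by lia) i, Nat.add_sub_cancel]
    · exact ih (by lia)
    · intro h1
      have h2 : i.val = t % n := congrArg Fin.val h1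
      rw [Nat.mod_eq_of_lt (by lia)] at h2
      lia

/-- The block about to be overwritten holds the iterate written `n` steps before; truncated
subtraction gives `x 0` in the first epoch. -/
lemma cyclic_old (hinit : ∀ i, z 0 i = x 0) (hact : ∀ t, 1 ≤ t → z t (idx n t) = x t)
    (hrest : ∀ t, 1 ≤ t → ∀ i, i ≠ idx n t → z t i = z (t - 1) i) (t : ℕ) :
    z t (idx n (t + 1)) = x (t + 1 - n) := by
  have hn := NeZero.pos n
  rcases lt_or_ge t n with h | h
  · rw [Nat.sub_eq_zero_of_le (by lia)]
    refine cyclic_init hinit hrest t _ ?_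
    simp [idx, Nat.mod_eq_of_lt h]
  · have h1 : idx n (t + 1) = idx n (t + 1 - n) := by
      ext
      simp only [idx, Nat.add_sub_cancel]
      rw [Nat.mod_eq_sub_mod h]
      congr 1
      lia
    have h2 := cyclic_hold hact hrest (s := t + 1 - n) (by lia) (n - 1) (by lia)
    rw [h1, ← h2]
    congr 1
    lia

/-- The stored points are, in some order, the last `n` iterates. -/
lemma sum_cyclic (hinit : ∀ i, z 0 i = x 0) (hact : ∀ t, 1 ≤ t → z t (idx n t) = x t)
    (hrest : ∀ t, 1 ≤ t → ∀ i, i ≠ idx n t → z t i = z (t - 1) i) (g : X → ℝ) (t : ℕ) :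
    ∑ i, g (z t i) = ∑ i ∈ Finset.range n, g (x (t - i)) := by
  induction t with
  | zero => simp [hinit]
  | succ t ih =>
    have h1 : ∑ i, g (z (t + 1) i) + g (z t (idx n (t + 1))) =
        ∑ i, g (z t i) + g (x (t + 1)) := by
      rw [← Finset.add_sum_erase _ _ (Finset.mem_univ (idx n (t + 1))),
        ← Finset.add_sum_erase (f := fun i => g (z t i)) _ (Finset.mem_univ (idx n (t + 1))),
        hact (t + 1) (by lia)]
      have : ∑ i ∈ Finset.univ.erase (idx n (t + 1)), g (z (t + 1) i) =
          ∑ i ∈ Finset.univ.erase (idx n (t + 1)), g (z t i) :=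
        Finset.sum_congr rfl fun i hi => by
          rw [hrest (t + 1) (by lia) i (Finset.ne_of_mem_erase hi), Nat.add_sub_cancel]
      rw [this]
      ring
    rw [cyclic_old hinit hact hrest, ih] at h1
    obtain ⟨m, rfl⟩ : ∃ m, n = m + 1 := ⟨n - 1, by have := NeZero.pos n; lia⟩
    rw [Finset.sum_range_succ']
    rw [Finset.sum_range_succ] at h1
    have e : ∀ i, t + 1 - (i + 1) = t - i := fun i => by lia
    simp only [e, Nat.sub_zero] at h1 ⊢
    linarith

lemma ceil_succ_div (t : ℕ) : ⌈((t + 1 : ℕ) : ℝ) / n⌉₊ = t / n + 1 := by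
  have hn : (0 : ℝ) < n := by exact_mod_cast NeZero.pos n
  have h1 := Nat.div_add_mod t n
  have h2 := Nat.mod_lt t (NeZero.pos n)
  rw [Nat.ceil_eq_iff (by lia), Nat.add_sub_cancel, lt_div_iff₀ hn, div_le_iff₀ hn]
  constructor
  · norm_cast
    rw [mul_comm]
    lia
  · norm_cast
    rw [add_mul, mul_comm]
    lia

lemma ceil_succ_div_sub_one (t : ℕ) : ⌈((t + 1 : ℕ) : ℝ) / n - 1⌉₊ = t / n := by
  rw [Nat.ceil_sub_one, ceil_succ_div, Nat.add_sub_cancel]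

end Index

/-! ### The invariant along a run, and scalar estimates -/

section Run

variable {d n : ℕ} [NeZero n] {μ L Lt : ℝ}

/-- The point `z` is `R`-close to `xs`, and `D` dominates `w ∇²f(z)` with error at most `b`. -/
structure Block (f : EuclideanSpace ℝ (Fin d) → ℝ) (xs : EuclideanSpace ℝ (Fin d)) (w b R : ℝ)
    (z : EuclideanSpace ℝ (Fin d)) (D : Matrix (Fin d) (Fin d) ℝ) : Prop where
  close : ‖z - xs‖ ≤ R
  dominates : (D - w • hess f z).PosSemidef
  error : sigma D (hess f z) ≤ b

lemma Block.smul {f : EuclideanSpace ℝ (Fin d) → ℝ} {xs z : EuclideanSpace ℝ (Fin d)}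
    {b R w : ℝ} {D : Matrix (Fin d) (Fin d) ℝ} (h : Block f xs 1 b R z D) (hw : 0 ≤ w)
    (hH : (hess f z).PosDef) : Block f xs w (w * (b + d) - d) R z (w • D) where
  close := h.close
  dominates := by simpa [smul_sub] using h.dominates.smul hw
  error := by
    rw [sigma_smul hH]
    have := mul_le_mul_of_nonneg_left h.error hw
    linarith

/-- The state of the method after `t` iterations: the blocks updated in the current epoch are
unscaled, the others carry the correction factor of the previous epoch. -/
def Inv (f : Fin n → EuclideanSpace ℝ (Fin d) → ℝ) (xs : EuclideanSpace ℝ (Fin d))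
    (α m R : ℕ → ℝ) (t : ℕ) (z : Fin n → EuclideanSpace ℝ (Fin d))
    (D : Fin n → Matrix (Fin d) (Fin d) ℝ) : Prop :=
  ∀ i : Fin n,
    (i.val < t % n → Block (f i) xs 1 (m (t / n + 1)) (R (t / n + 1)) (z i) (D i)) ∧
    (t % n ≤ i.val → Block (f i) xs ((1 + α (t / n)) ^ 2)
      ((1 + α (t / n)) ^ 2 * (m (t / n) + d) - d) (R (t / n)) (z i) (D i))

/-- `hRα` makes nearby Hessians comparable. In `hm`, one factor `(1 + α p)^2` comes from `omega` and
one from the change of metric, before the greedy contraction. `hmb` and `hsb` treat blocks already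
and not yet updated in the epoch. -/
lemma inv_step {f : Fin n → EuclideanSpace ℝ (Fin d) → ℝ}
    (hμ : 0 < μ) (hL : 0 < L) (hLt : 0 ≤ Lt) (hf : ∀ i, ContDiff ℝ 2 (f i))
    (hconv : ∀ i, StronglyConvex μ (f i)) (hsmooth : ∀ i, Smooth L (f i))
    (hlip : ∀ i, LipschitzHessian Lt (f i)) {xs : EuclideanSpace ℝ (Fin d)}
    (hgrad : ∑ i, gradient (f i) xs = 0) (hq : 0 ≤ 1 - μ / (d * L))
    {α m R c : ℕ → ℝ} (hα : ∀ p, 0 ≤ α p) (hRα : ∀ p, Lt * R p ≤ α p * μ)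
    (hRmono : ∀ p, R (p + 1) ≤ R p)
    (hm : ∀ p, (1 - μ / (d * L)) * ((1 + α p) ^ 2 * ((1 + α p) ^ 2 * (m p + d) - d + d) - d)
      ≤ m (p + 1))
    (hmb : ∀ p, 1 / μ * (L * m (p + 1) + Lt * R p) ≤ c p)
    (hsb : ∀ p, 1 / μ * (L * ((1 + α p) ^ 2 * (m p + d) - d) + Lt * R p) ≤ c p)
    (hc : ∀ p, 0 ≤ c p) (hcR : ∀ p, c p * R p ≤ R (p + 1))
    {x0 : EuclideanSpace ℝ (Fin d)} {I0 : Fin n → Matrix (Fin d) (Fin d) ℝ}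
    {x : ℕ → EuclideanSpace ℝ (Fin d)} {z : ℕ → Fin n → EuclideanSpace ℝ (Fin d)}
    {D : ℕ → Fin n → Matrix (Fin d) (Fin d) ℝ} {Q : ℕ → Matrix (Fin d) (Fin d) ℝ}
    {u : ℕ → Fin d → ℝ} (hrun : IsRun f α x0 I0 x z D Q u) {t : ℕ}
    (hinv : Inv f xs α m R t (z t) (D t)) :
    (∀ i, (D t i).PosDef) ∧ (Q (t + 1)).PosDef ∧
    ‖x (t + 1) - xs‖ ≤ c (t / n) * ((1 / (n : ℝ)) * ∑ i, ‖z t i - xs‖) ∧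
    Inv f xs α m R (t + 1) (z (t + 1)) (D (t + 1)) := by
  have hn := NeZero.pos n
  have hnR : (0 : ℝ) < n := by exact_mod_cast hn
  have ht : 1 ≤ t + 1 := by lia
  set p := t / n with hp
  have hH := fun i y => hess_posDef (hf i) hμ (hconv i) y
  have hz : ∀ i, ‖z t i - xs‖ ≤ R p := fun i => by
    rcases lt_or_ge i.val (t % n) with h | h
    · exact ((hinv i).1 h).close.trans (hRmono p)
    · exact ((hinv i).2 h).close
  have hdom : ∀ i, (D t i - hess (f i) (z t i)).PosSemidef := fun i => by
    rcases lt_or_ge i.val (t % n) with h | h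
    · simpa using ((hinv i).1 h).dominates
    · have h1 := ((hinv i).2 h).dominates
      have h2 : 0 ≤ (1 + α p) ^ 2 - 1 := by nlinarith [hα p]
      convert h1.add ((hH i (z t i)).posSemidef.smul h2) using 1
      module
  have hDpos := fun i => posDef_of_posSemidef_sub (hdom i) (hH i _)
  have hxb : ‖x (t + 1) - xs‖ ≤ c p * ((1 / (n : ℝ)) * ∑ i, ‖z t i - xs‖) := by
    have h1 := norm_step_le hμ hL hLt hf hconv hsmooth hlip hgrad (x := x (t + 1)) (D := D t)
      (z := z t) (b := max (m (p + 1)) ((1 + α p) ^ 2 * (m p + d) - d)) (R := R p) hdom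
      (fun i => by
        rcases lt_or_ge i.val (t % n) with h | h
        · exact ((hinv i).1 h).error.trans (le_max_left _ _)
        · exact ((hinv i).2 h).error.trans (le_max_right _ _)) hz
      (by simpa using hrun.x_step (t + 1) ht)
    refine h1.trans (mul_le_mul_of_nonneg_right ?_ (by positivity))
    rcases max_choice (m (p + 1)) ((1 + α p) ^ 2 * (m p + d) - d) with h | h
    · rw [h]; exact hmb p
    · rw [h]; exact hsb p
  have hxR : ‖x (t + 1) - xs‖ ≤ R (p + 1) := by
    refine hxb.trans ((mul_le_mul_of_nonneg_left ?_ (hc p)).trans (hcR p))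
    rw [one_div, inv_mul_le_iff₀ hnR]
    calc ∑ i, ‖z t i - xs‖ ≤ ∑ _i : Fin n, R p := Finset.sum_le_sum fun i _ => hz i
      _ = n * R p := by simp
  set k := idx n (t + 1) with hk
  have hkv : k.val = t % n := rfl
  have hzk : z (t + 1) k = x (t + 1) := hrun.z_active (t + 1) ht
  have hblock := (hinv k).2 hkv.ge
  have hQ := hrun.Q_step (t + 1) ht
  rw [ceil_succ_div_sub_one, ← hp, ← hk, Nat.add_sub_cancel] at hQ
  obtain ⟨hQpos, hQdom, hQσ⟩ := bfgs_avgHess (hf k) hμ (hconv k) (hlip k) (hα p)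
    (z := z t k) (z' := z (t + 1) k) (by
      -- This 2 from the triangle inequality is offset by the 1/2 from averaging the Hessian.
      have h1 : ‖z (t + 1) k - z t k‖ ≤ 2 * R p := by
        have h2 := norm_sub_le (z (t + 1) k - xs) (z t k - xs)
        rw [sub_sub_sub_cancel_right] at h2
        rw [hzk] at h2 ⊢
        linarith [hz k, hRmono p]
      have := mul_le_mul_of_nonneg_left h1 hLt
      linarith [hRα p]) hblock.dominates hblock.error (z (t + 1) k - z t k).ofLp
  rw [← hQ] at hQpos hQdom hQσ
  refine ⟨hDpos, hQpos, hxb, ?_⟩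
  have hu := hrun.u_greedy (t + 1) ht
  rw [← hk] at hu
  have hnew : Block (f k) xs 1 (m (p + 1)) (R (p + 1)) (z (t + 1) k)
      (bfgs (Q (t + 1)) (hess (f k) (z (t + 1) k)) (u (t + 1))) := by
    refine ⟨by rwa [hzk], ?_, ?_⟩
    · rw [one_smul]
      exact bfgs_sub_posSemidef (hH k _) hQdom _
    · exact ((sigma_bfgs_greedy_le hμ hL (hH k _) hQdom (form_hess_ge (hf k) (hconv k) _)
        (form_hess_le (hf k) (hsmooth k) _) hu).trans (mul_le_mul_of_nonneg_left hQσ hq)).trans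
        (hm p)
  set w := omega α n (t + 1) with hw
  have hDk : D (t + 1) k = w • bfgs (Q (t + 1)) (hess (f k) (z (t + 1) k)) (u (t + 1)) :=
    hrun.D_active (t + 1) ht
  have hDi : ∀ i, i ≠ k → z (t + 1) i = z t i ∧ D (t + 1) i = w • D t i := fun i hi =>
    ⟨hrun.z_rest (t + 1) ht i hi, hrun.D_rest (t + 1) ht i hi⟩
  -- Before scaling by `w`, the updated blocks are those up to index `t % n`; at the end of an epoch
  -- this is all of them, and `omega` scales them together.
  have hupd : ∀ i : Fin n, i.val ≤ t % n → ∃ D', D (t + 1) i = w • D' ∧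
      Block (f i) xs 1 (m (p + 1)) (R (p + 1)) (z (t + 1) i) D' := by
    intro i hi
    by_cases hik : i = k
    · subst hik
      exact ⟨_, hDk, hnew⟩
    · have hlt : i.val < t % n := lt_of_le_of_ne hi fun h => hik (Fin.ext h)
      refine ⟨_, (hDi i hik).2, ?_⟩
      rw [(hDi i hik).1]
      exact (hinv i).1 hlt
  have hmod := Nat.mod_lt t hn
  have hdm := Nat.div_add_mod t n
  by_cases hend : t % n + 1 = n
  · have h0 : t + 1 = n * (p + 1) := by rw [mul_add]; lia
    have h1 : (t + 1) % n = 0 := by rw [h0, Nat.mul_mod_right]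
    have h2 : (t + 1) / n = p + 1 := by rw [h0, Nat.mul_div_cancel_left _ hn]
    have hw' : w = (1 + α (p + 1)) ^ 2 := by
      rw [hw, omega, if_pos h1, ceil_succ_div]
    intro i
    rw [h1, h2]
    refine ⟨fun h => absurd h (by lia), fun _ => ?_⟩
    obtain ⟨D', e, hb⟩ := hupd i (by have := i.isLt; lia)
    rw [e, ← hw']
    exact hb.smul (hw' ▸ sq_nonneg _) (hH i _)
  · have h0 : t + 1 = t % n + 1 + n * p := by lia
    have h1 : (t + 1) % n = t % n + 1 := by
      rw [h0, Nat.add_mul_mod_self_left, Nat.mod_eq_of_lt (by lia)]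
    have h2 : (t + 1) / n = p := by
      rw [h0, Nat.add_mul_div_left _ _ hn, Nat.div_eq_of_lt (by lia), zero_add]
    have hw' : w = 1 := by
      rw [hw, omega, if_neg (by lia)]
    intro i
    rw [h1, h2]
    constructor
    · intro h
      obtain ⟨D', e, hb⟩ := hupd i (by lia)
      rwa [e, hw', one_smul]
    · intro h
      have hik : i ≠ k := fun h' => by rw [h'] at h; lia
      rw [(hDi i hik).1, (hDi i hik).2, hw', one_smul]
      exact (hinv i).2 (by lia)

/-- The factor `2 - (ρ/q)^p` stays in `[1, 2]` and grows by `(ρ/q)^p (1 - ρ/q)`. After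
multiplication by `c q^p` this is of order `ρ^p`, enough room for the inflation. The 15 is `4 + 6 +
4 + 1`, from `(1 + y)^4 ≤ 1 + 15 y` on `[0, 1]`. -/
lemma one_add_mul_pow_le {a c d ρ q : ℝ} (ha : 0 ≤ a) (ha1 : a ≤ 1) (hc : 0 < c) (hd : 0 ≤ d)
    (hρ : 0 < ρ) (hρq : ρ < q) (hq : q ≤ 1)
    (h : 15 * a * (2 * c + d) ≤ c * (1 - ρ / q)) (p : ℕ) :
    (1 + a * ρ ^ p) ^ 4 * (c * (2 - (ρ / q) ^ p) * q ^ p + d) - d ≤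
      c * (2 - (ρ / q) ^ (p + 1)) * q ^ p := by
  have hq0 : 0 < q := hρ.trans hρq
  have hr0 : 0 < ρ / q := by positivity
  have hr1 : ρ / q ≤ 1 := by rw [div_le_one hq0]; exact hρq.le
  have hρp : ρ ^ p = (ρ / q) ^ p * q ^ p := by rw [← mul_pow, div_mul_cancel₀ _ hq0.ne']
  have hT0 : 0 < q ^ p := by positivity
  have hT1 : q ^ p ≤ 1 := pow_le_one₀ hq0.le hq
  have hR0 : 0 < (ρ / q) ^ p := by positivity
  have hR1 : (ρ / q) ^ p ≤ 1 := pow_le_one₀ hr0.le hr1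
  rw [hρp, pow_succ (ρ / q) p]
  set r := ρ / q
  set S := r ^ p
  set T := q ^ p
  have hST : S * T ≤ 1 := mul_le_one₀ hR1 hT0.le hT1
  have hy0 : 0 ≤ a * (S * T) := by positivity
  have hy1 : a * (S * T) ≤ 1 := mul_le_one₀ ha1 (by positivity) hST
  have h4 : (1 + a * (S * T)) ^ 4 ≤ 1 + 15 * (a * (S * T)) := by
    set y := a * (S * T)
    have h2 : y ^ 2 ≤ y := by nlinarith
    have h3 : y ^ 3 ≤ y := by nlinarith
    have h4 : y ^ 4 ≤ y := by nlinarith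
    linarith [show (1 + y) ^ 4 = 1 + 4 * y + 6 * y ^ 2 + 4 * y ^ 3 + y ^ 4 by ring]
  have hm0 : 0 ≤ c * (2 - S) * T := mul_nonneg (mul_nonneg hc.le (by linarith)) hT0.le
  have hm1 : c * (2 - S) * T ≤ 2 * c := by
    have : c * (2 - S) ≤ 2 * c := by nlinarith
    calc c * (2 - S) * T ≤ 2 * c * 1 := by gcongr
      _ = 2 * c := mul_one _
  have h5 : (1 + a * (S * T)) ^ 4 * (c * (2 - S) * T + d) ≤
      (1 + 15 * (a * (S * T))) * (c * (2 - S) * T + d) := by gcongr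
  have h6 : 15 * (a * (S * T)) * (c * (2 - S) * T + d) ≤ S * T * (c * (1 - r)) := by
    calc 15 * (a * (S * T)) * (c * (2 - S) * T + d)
        ≤ 15 * (a * (S * T)) * (2 * c + d) := by gcongr
      _ = S * T * (15 * a * (2 * c + d)) := by ring
      _ ≤ S * T * (c * (1 - r)) := by gcongr
  linarith

lemma strongConvexity_le_smoothness (hd : 0 < d) {f : EuclideanSpace ℝ (Fin d) → ℝ}
    (hconv : StronglyConvex μ f) (hsmooth : Smooth L f) : μ ≤ L := by
  have h1 := hconv 0 (EuclideanSpace.single ⟨0, hd⟩ 1)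
  have h2 := hsmooth 0 (EuclideanSpace.single ⟨0, hd⟩ 1)
  simp only [sub_zero, PiLp.norm_single, norm_one, one_pow, mul_one] at h1 h2
  linarith

/-- The product is `√(L/μ)`; this is why `α p` dominates `Lt * R p / μ`. -/
lemma one_le_rpow_mul_sqrt (hμ : 0 < μ) (hμL : μ ≤ L) :
    1 ≤ μ ^ (-(3 / 2) : ℝ) * √L * μ := by
  calc (1 : ℝ) = μ ^ (-(3 / 2) : ℝ) * μ ^ (1 / 2 : ℝ) * μ ^ (1 : ℝ) := by
        rw [← Real.rpow_add hμ, ← Real.rpow_add hμ]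
        norm_num
    _ = μ ^ (-(3 / 2) : ℝ) * √μ * μ := by rw [Real.rpow_one, Real.sqrt_eq_rpow]
    _ ≤ μ ^ (-(3 / 2) : ℝ) * √L * μ := by gcongr

end Run

end SLIQN

/-! ### Choice of constants and conclusion -/

theorem lemma3 {d n : ℕ} [NeZero n] (f : Fin n → EuclideanSpace ℝ (Fin d) → ℝ)
    (μ L Lt : ℝ) (hμ : 0 < μ) (hL : 0 < L) (hLt : 0 ≤ Lt)
    (hC2 : ∀ i, ContDiff ℝ 2 (f i))
    (hconv : ∀ i, SLIQN.StronglyConvex μ (f i))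
    (hsmooth : ∀ i, SLIQN.Smooth L (f i))
    (hlip : ∀ i, SLIQN.LipschitzHessian Lt (f i))
    (xs : EuclideanSpace ℝ (Fin d))
    (hxs : IsMinOn (fun y => (1 / (n : ℝ)) * ∑ i, f i y) Set.univ xs)
    (ρ : ℝ) (hρ0 : 0 < ρ) (hρ1 : ρ < 1 - μ / (d * L)) :
    ∃ ε σ₀ : ℝ, 0 < ε ∧ 0 < σ₀ ∧
      ∀ (x0 : EuclideanSpace ℝ (Fin d)) (I0 : Fin n → Matrix (Fin d) (Fin d) ℝ),
        ‖x0 - xs‖ ≤ ε →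
        (∀ i, (I0 i - SLIQN.hess (f i) x0).PosSemidef) →
        (∀ i, SLIQN.sigma (I0 i) (SLIQN.hess (f i) x0) ≤ σ₀) →
        ∀ (x : ℕ → EuclideanSpace ℝ (Fin d)) (z : ℕ → Fin n → EuclideanSpace ℝ (Fin d))
          (D : ℕ → Fin n → Matrix (Fin d) (Fin d) ℝ) (Q : ℕ → Matrix (Fin d) (Fin d) ℝ)
          (u : ℕ → Fin d → ℝ),
          SLIQN.IsRun f (SLIQN.alpha μ L Lt ε ρ) x0 I0 x z D Q u →
          ∀ t : ℕ, 1 ≤ t →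
            -- all matrices inverted or used as denominators are positive definite
            (∀ i, (D (t - 1) i).PosDef) ∧ (Q t).PosDef ∧
            -- `x (t - i)` is `x 0` when `t < i`
            ‖x t - xs‖ ≤ (1 - μ / (d * L)) ^ ⌈(t : ℝ) / n⌉₊ *
              ((1 / (n : ℝ)) * ∑ i ∈ Finset.Icc 1 n, ‖x (t - i) - xs‖) := by
  have hgrad := SLIQN.sum_gradient_eq_zero hC2 hxs
  have hq1 : 1 - μ / (d * L) ≤ 1 := by
    have : 0 ≤ μ / (d * L) := by positivity
    linarith
  set q := 1 - μ / (d * L) with hqdef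
  have hq0 : 0 < q := hρ0.trans hρ1
  have hd0 : (0 : ℝ) ≤ d := Nat.cast_nonneg d
  have hr1 : ρ / q < 1 := by rwa [div_lt_one hq0]
  set κ := Lt * μ ^ (-(3 / 2) : ℝ) * √L with hκ
  have hκ0 : 0 ≤ κ := by positivity
  -- Errors stay below `2 c q^p`, so `L * sigma` uses half of the budget `μ ρ q^p`; `η ≤ μ ρ / 2`
  -- reserves the other half for `Lt * R p`.
  set c := ρ * μ / (4 * L) with hcdef
  have hc0 : 0 < c := by positivity
  set η := min 1 (min (μ * ρ / 2) (c * (1 - ρ / q) / (15 * (2 * c + d)))) with hη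
  have hη0 : 0 < η := by
    refine lt_min one_pos (lt_min (by positivity) (div_pos (mul_pos hc0 (by linarith)) ?_))
    positivity
  set ε := η / (1 + Lt + κ) with hε
  have hε0 : 0 < ε := by positivity
  have hεη : (1 + Lt + κ) * ε = η := by rw [hε]; field_simp
  have hLtε : Lt * ε ≤ η := by nlinarith
  have hκε : κ * ε ≤ η := by nlinarith
  have hη2 : η ≤ μ * ρ / 2 := (min_le_right _ _).trans (min_le_left _ _)
  have hη3 : η ≤ c * (1 - ρ / q) / (15 * (2 * c + d)) :=
    (min_le_right _ _).trans (min_le_right _ _)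
  have ha : 15 * (κ * ε) * (2 * c + d) ≤ c * (1 - ρ / q) := by
    rw [le_div_iff₀ (by positivity)] at hη3
    have : κ * ε * (15 * (2 * c + d)) ≤ η * (15 * (2 * c + d)) := by gcongr
    linarith
  have hαdef : ∀ p, SLIQN.alpha μ L Lt ε ρ p = κ * ε * ρ ^ p := fun p => rfl
  have hα0 : ∀ p, 0 ≤ SLIQN.alpha μ L Lt ε ρ p := fun p => by
    rw [hαdef]; positivity
  set m : ℕ → ℝ := fun p => c * (2 - (ρ / q) ^ p) * q ^ p with hm
  have hpow : ∀ p, (1 + SLIQN.alpha μ L Lt ε ρ p) ^ 4 * (m p + d) - d ≤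
      c * (2 - (ρ / q) ^ (p + 1)) * q ^ p := fun p => by
    rw [hαdef]
    exact SLIQN.one_add_mul_pow_le (by positivity) (hκε.trans (min_le_left _ _)) hc0 hd0 hρ0
      hρ1 hq1 ha p
  have hrp : ∀ p, 0 ≤ (ρ / q) ^ p ∧ (ρ / q) ^ p ≤ 1 := fun p =>
    ⟨by positivity, pow_le_one₀ (by positivity) hr1.le⟩
  have hm0 : ∀ p, 0 ≤ m p := fun p =>
    mul_nonneg (mul_nonneg hc0.le (by linarith [(hrp p).2])) (by positivity)
  have hs2 : ∀ p, c * (2 - (ρ / q) ^ (p + 1)) * q ^ p ≤ 2 * c * q ^ p := fun p => by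
    refine mul_le_mul_of_nonneg_right ?_ (by positivity)
    nlinarith [(hrp (p + 1)).1]
  have hcontr : ∀ p b, b ≤ 2 * c * q ^ p →
      1 / μ * (L * b + Lt * (ε * ρ ^ p)) ≤ ρ * q ^ p := by
    intro p b hb
    have h1 : ρ ^ p ≤ q ^ p := pow_le_pow_left₀ hρ0.le hρ1.le p
    have h2 : Lt * (ε * ρ ^ p) ≤ μ * ρ / 2 * q ^ p := by
      rw [← mul_assoc]
      exact mul_le_mul (hLtε.trans hη2) h1 (by positivity) (by positivity)
    have h3 : L * b ≤ μ * ρ / 2 * q ^ p := by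
      calc L * b ≤ L * (2 * c * q ^ p) := by gcongr
        _ = μ * ρ / 2 * q ^ p := by rw [hcdef]; field_simp; ring
    rw [one_div, inv_mul_le_iff₀ hμ]
    linarith
  -- The admissible initial error is `m 0 = c`.
  refine ⟨ε, c, hε0, hc0, ?_⟩
  intro x0 I0 hx0 hI0 hσ0 x z D Q u hrun
  -- A greedy basis vector exists, which excludes dimension zero; this is needed for `μ ≤ L`.
  have hd : 0 < d := by
    obtain ⟨⟨k, -⟩, -⟩ := hrun.u_greedy 1 le_rfl
    exact k.pos
  have hμL := SLIQN.strongConvexity_le_smoothness hd (hconv 0) (hsmooth 0)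
  have hstep : ∀ t, SLIQN.Inv f xs (SLIQN.alpha μ L Lt ε ρ) m (fun p => ε * ρ ^ p) t (z t) (D t) →
      _ := fun t => SLIQN.inv_step hμ hL hLt hC2 hconv hsmooth hlip hgrad hq0.le hα0
    (R := fun p => ε * ρ ^ p) (c := fun p => ρ * q ^ p)
    (fun p => by
      rw [hαdef]
      have := mul_le_mul_of_nonneg_left (SLIQN.one_le_rpow_mul_sqrt hμ hμL)
        (show 0 ≤ Lt * (ε * ρ ^ p) by positivity)
      rw [hκ]
      linarith)
    (fun p => by
      refine mul_le_mul_of_nonneg_left ?_ hε0.le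
      exact pow_le_pow_of_le_one hρ0.le (hρ1.le.trans hq1) (Nat.le_succ p))
    (fun p => by
      have := mul_le_mul_of_nonneg_left (hpow p) hq0.le
      calc _ = q * ((1 + SLIQN.alpha μ L Lt ε ρ p) ^ 4 * (m p + d) - d) := by ring
        _ ≤ _ := this
        _ = m (p + 1) := by simp only [hm]; ring)
    (fun p => hcontr p _ (by
      have h1 : m (p + 1) = q * (c * (2 - (ρ / q) ^ (p + 1)) * q ^ p) := by simp only [hm]; ring
      have h2 : 0 ≤ c * (2 - (ρ / q) ^ (p + 1)) * q ^ p :=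
        mul_nonneg (mul_nonneg hc0.le (by linarith [(hrp (p + 1)).2])) (by positivity)
      rw [h1]
      exact (mul_le_of_le_one_left h2 hq1).trans (hs2 p)))
    (fun p => hcontr p _ (by
      refine le_trans ?_ ((hpow p).trans (hs2 p))
      have : (1 + SLIQN.alpha μ L Lt ε ρ p) ^ 2 ≤ (1 + SLIQN.alpha μ L Lt ε ρ p) ^ 4 :=
        pow_le_pow_right₀ (by linarith [hα0 p]) (by norm_num)
      have := mul_le_mul_of_nonneg_right this (add_nonneg (hm0 p) hd0)
      linarith))
    (fun p => by positivity)
    (fun p => by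
      have h1 : q ^ p ≤ 1 := pow_le_one₀ hq0.le hq1
      calc ρ * q ^ p * (ε * ρ ^ p) ≤ ρ * 1 * (ε * ρ ^ p) := by gcongr
        _ = ε * ρ ^ (p + 1) := by ring)
    hrun (t := t)
  have hinv : ∀ t, SLIQN.Inv f xs (SLIQN.alpha μ L Lt ε ρ) m (fun p => ε * ρ ^ p) t
      (z t) (D t) := by
    intro t
    induction t with
    | zero =>
      intro i
      refine ⟨fun h => absurd h (by simp), fun _ => ?_⟩
      rw [hrun.z_init, hrun.D_init, Nat.zero_div]
      refine SLIQN.Block.smul ⟨by simpa using hx0, by simpa using hI0 i, ?_⟩ (sq_nonneg _)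
        (SLIQN.hess_posDef (hC2 i) hμ (hconv i) _)
      refine (hσ0 i).trans_eq ?_
      simp only [hm, pow_zero]
      ring
    | succ t ih => exact (hstep t ih).2.2.2
  intro t ht
  obtain ⟨t, rfl⟩ : ∃ s, t = s + 1 := ⟨t - 1, by lia⟩
  obtain ⟨hD, hQ, hx, -⟩ := hstep t (hinv t)
  refine ⟨by simpa using hD, hQ, hx.trans ?_⟩
  have hsum := SLIQN.sum_cyclic (fun i => (hrun.z_init i).trans hrun.x_init.symm) hrun.z_active
    hrun.z_rest (fun y => ‖y - xs‖) t
  have hIcc : ∑ i ∈ Finset.Icc 1 n, ‖x (t + 1 - i) - xs‖ =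
      ∑ i ∈ Finset.range n, ‖x (t - i) - xs‖ := by
    rw [Finset.range_eq_Ico, Finset.sum_Ico_eq_sum_range, ← Finset.Ico_add_one_right_eq_Icc,
      Finset.sum_Ico_eq_sum_range]
    refine Finset.sum_congr (by simp) fun i _ => ?_
    congr 3
    lia
  rw [SLIQN.ceil_succ_div, hIcc, hsum]
  refine mul_le_mul_of_nonneg_right ?_ (by positivity)
  -- The contraction obtained is `ρ q^p`, and `ρ < q`.
  rw [pow_succ']
  gcongr
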